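/- **Setting.** Fix $K\ge 0$. For $k=0,\dots,K$ (target $k=0$, sources $k\ge1$) let $X^{(k)}\in\mathbb R^{n_k\times p}$ be a fixed design, $n_k\ge1$, and let $y^{(k)}=X^{(k)}\beta^{(k)*}+\varepsilon^{(k)}$ with independent $\varepsilon^{(k)}\sim N(0,\sigma^2I_{n_k})$, $\sigma>0$ known, $\beta^{(k)*}=\beta^{(0)*}+\delta^{(k)*}$ for $k\ge1$. Put $N=\sum_{k=0}^K n_k$. For levels $\zeta_j,h^{(k)}_j\ge0$ let $S^*=\{j:|\beta^{(0)*}_j|\ge\zeta_j\}$, $s^*=|S^*|$, $T_k^*=\{j:|\delta_j^{(k)*}|\ge h_j^{(k)}\}$. For $S\subseteq[p]$ let $H^{(j)}_S=\{k\in[K]: j\in S\setminus T^*_k\}$, $H_S=\bigcup_{j\in S}H_S^{(j)}$, $n_S^{(j)}=n_0+\sum_{k\in H_S^{(j)}}n_k$, $n_S=n_0+\sum_{k\in H_S}n_k$; write $n_{S^*,T^*}=n_{S^*}$. Let $\tilde Q_0=I$, let $\tilde Q_k$ ($k\ge1$) be the orthogonal projection onto the orthogonal complement of the columns of $X^{(k)}$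 in $T_k^*$, $\tilde X^{(k)}=\tilde Q_kX^{(k)}$, $\tilde Q=\mathrm{diag}(\tilde Q_0,\dots,\tilde Q_K)$, $\tilde{\boldsymbol X}$ the stacked matrix of all $\tilde X^{(k)}$ (with $\tilde{\boldsymbol X}_S$ its columns in $S$), $\tilde{\boldsymbol X}_{H_S}$ the stack over $k\in H_S\cup\{0\}$, and $\Phi_S=\tilde{\boldsymbol X}_S(\tilde{\boldsymbol X}_S^\top\tilde{\boldsymbol X}_S)^{-1}\tilde{\boldsymbol X}_S^\top$. **Prior and posterior (oracle case: the $T_k^*$ are known).** Each $j\in[p]$ belongs to $S$ independently with probability $q_0\in(0,1)$, subject to $|S|\le L_s$; given $S$, the $\beta_j^{(0)}$ are independent, $N(0,\sigma^2\eta^2)$ for $j\in S$ and $0$ for $j\notin S$; independently, the $\delta^{(k)}_j$ are independent, $N(0,\sigma^2\tau_k^2)$ for $j\in T_k^*$ and $0$ otherwise; $\beta^{(k)}=\beta^{(0)}+\delta^{(k)}$. $\Pi(\cdot\mid\{y^{(k)}\}_{k=0}^{K})$ is the posterior under the Gaussian likelihood. **Theorem.** Let $K$ and constants $c_0\in(1/2,1)$,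 $C_1,C_2>0$, $\lambda_l,d_1,d_2\in(0,1)$, $C_3\ge8\lambda_l^{-1}$, $r>1+\tfrac32C_1\lambda_l^{-1}+C_2+C_3$ and $\kappa>0$ be given. There are constants $A,\tilde c_2,\tilde c_3,\tilde c_4,M>0$ depending only on these such that the following holds for all $p$ and all instances of the setting that satisfy: 0. $s^*\ge1$; $L_s\ge A s^*$; $N\le p^{\kappa}$; $n_S\ge\kappa^{-1}\log p$ for all $S$ with $1\le|S|\le L_s$. 1. (True model) $\|X^{(k)}\beta^{(k)*}\|_2^2\le C_1n_k\sigma^2\log p$ for all $k\ge0$; $\|\tilde{\boldsymbol X}_{S^{*c}}\beta^{(0)*}_{S^{*c}}\|_2^2\le\frac{C_2}2\sigma^2\log p$; $\sum_{k=1}^K\|\tilde X^{(k)}_{T_k^{*c}}\delta^{(k)*}_{T_k^{*c}}\|_2^2\le\frac{C_2}2\sigma^2\log p$; $\min_{j\in[p]}n^{(j)}_{[p]}\ge c_0N$. 2. (Design) $\|X_j^{(k)}\|_2^2=n_k$ for all $j$ and $k\ge0$; $\lambda_{\min}(\tilde{\boldsymbol X}_{H_S,S}^\top\tilde{\boldsymbol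 X}_{H_S,S}/n_S)\ge\lambda_l$ for all $|S|\le L_s$; $\lambda_{\min}(X^{(0)\top}_{S^*}X^{(0)}_{S^*})\ge n_0\lambda_l$; $\lambda_{\min}(X^{(k)\top}_{T^*_k}X^{(k)}_{T^*_k})\ge n_k\lambda_l$ for all $k\ge1$ with $T_k^*\neq\emptyset$; for $Z\sim N(0,I_N)$, $$\mathbb E_Z\Big[\max_{|S_1|\le|S_2|\le L_s}\ \max_{j\in S_2\setminus S_1}\tfrac1{\sqrt{n^{(j)}_{S_2}}}\big|Z^\top\tilde Q(I_N-\Phi_{S_1})\tilde{\boldsymbol X}_j\big|\Big]\le\tfrac12\sqrt{C_3\lambda_l\log p};$$ $\|\tilde X_j^{(k)}\|_2^2\ge d_1n_k$ for $k\ge1$, $j\notin T_k^*$; $\tilde{\boldsymbol X}_j^\top(I-\Phi_S)\tilde{\boldsymbol X}_j\ge d_1d_2n_S^{(j)}$ for $|S|\le L_s$, $j\notin S$. 3. (Prior) $\kappa^{-1}p^{-1}\le q_0\le\kappa p^{-1}$; $\kappa^{-1}(n_{S^*}\vee p^{2r})\le n_{S^*}\eta^2\le\kappa(n_{S^*}\vee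 p^{2r})$; $\tau_k^2\ge\kappa^{-1}$ for $k\ge1$. 4. (Large signal) $\zeta_j^2\ge 8\big(\tfrac32C_1\lambda_l^{-1}+r+3+\tfrac{C_2+C_3}4\big)\dfrac{\sigma^2\log p}{n^{(j)}_{S^*}d_1d_2}$ for $j\in S^*$. 5. (Negligible coefficients) $\|\beta^{(0)*}_{S^{*c}}\|_1\le\kappa\sigma s^*\sqrt{\log p/n_{S^*,T^*}}$ and $\|\beta^{(0)*}_{S^{*c}}\|_2\le\kappa\sigma\sqrt{s^*\log p/n_{S^*,T^*}}$. Then, with probability at least $1-\tilde c_3p^{-\tilde c_4}$ under the true law of the data, $$\Pi\Big(\|\beta^{(0)}-\beta^{(0)*}\|_1\ge M\sigma s^*\sqrt{\tfrac{\log p}{n_{S^*,T^*}}}\ \Big|\ \{y^{(k)}\}\Big)\le\tilde c_2p^{-1}\quad\text{and}\quad \Pi\Big(\|\beta^{(0)}-\beta^{(0)*}\|_2\ge M\sigma\sqrt{\tfrac{s^*\log p}{n_{S^*,T^*}}}\ \Big|\ \{y^{(k)}\}\Big)\le\tilde c_2p^{-1}.$$ -/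

import Mathlib

open MeasureTheory ProbabilityTheory
open scoped Matrix

noncomputable section

namespace Transfer

/-- One instance of the multi-source linear regression problem: a target data set (index `0`) and
`K` source data sets (indices `1, …, K`), `p` covariates, fixed designs, the true parameters, the
levels that define the true index sets, and the hyperparameters of the prior. -/
structure Problem (K p : ℕ) where
  /-- sample sizes `n_0, …, n_K` -/
  n : Fin (K + 1) → ℕ
  n_pos : ∀ k, 0 < n k
  /-- design matrices `X^{(0)}, …, X^{(K)}` -/
  X : (k : Fin (K + 1)) → Matrix (Fin (n k)) (Fin p) ℝ
  /-- common known noise standard deviation -/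
  σ : ℝ
  σ_pos : 0 < σ
  /-- true target coefficient `β^{(0)*}` -/
  β : Fin p → ℝ
  /-- true contrasts `δ^{(k)*} = β^{(k)*} - β^{(0)*}` of the sources -/
  δ : Fin K → Fin p → ℝ
  /-- signal levels -/
  ζ : Fin p → ℝ
  ζ_nonneg : ∀ j, 0 ≤ ζ j
  /-- heterogeneity levels -/
  h : Fin K → Fin p → ℝ
  h_nonneg : ∀ k j, 0 ≤ h k j
  /-- prior inclusion probability of a target signal -/
  q₀ : ℝ
  q₀_pos : 0 < q₀
  q₀_lt_one : q₀ < 1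
  /-- scale of the slab of the target coefficients, relative to the noise -/
  η : ℝ
  η_pos : 0 < η
  /-- scales of the slabs of the contrasts, relative to the noise -/
  τ : Fin K → ℝ
  τ_pos : ∀ k, 0 < τ k
  /-- largest number of target signals of the models considered -/
  Ls : ℕ

/-- The submatrix `A_D` of the columns of `A` with index in `D`. -/
def cols {ι : Type*} {p : ℕ} (A : Matrix ι (Fin p) ℝ) (D : Finset (Fin p)) : Matrix ι D ℝ :=
  A.submatrix id Subtype.val

/-- `A_D v_D`. -/
def colsMulVec {ι : Type*} {p : ℕ} (A : Matrix ι (Fin p) ℝ) (D : Finset (Fin p))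
    (v : Fin p → ℝ) : ι → ℝ :=
  cols A D *ᵥ fun j => v j

/-- The squared Euclidean norm. -/
def sqNorm {ι : Type*} [Fintype ι] (v : ι → ℝ) : ℝ := ∑ i, v i ^ 2

/-- The matrix `A_D (A_Dᵀ A_D)⁻¹ A_Dᵀ`: the orthogonal projection onto the span of the columns of
`A` with index in `D`, when these are linearly independent. -/
def proj {ι : Type*} [Fintype ι] {p : ℕ} (A : Matrix ι (Fin p) ℝ) (D : Finset (Fin p)) :
    Matrix ι ι ℝ :=
  cols A D * ((cols A D)ᵀ * cols A D)⁻¹ * (cols A D)ᵀ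

/-- `c ≤ λ_min(A)` for a symmetric matrix `A`. -/
def MinEigenvalueGE {ι : Type*} [DecidableEq ι] (A : Matrix ι ι ℝ) (c : ℝ) : Prop :=
  (A - c • (1 : Matrix ι ι ℝ)).PosSemidef

/-- `x` and `y` are of the same order, with implied constant `κ`. -/
def SameOrder (κ x y : ℝ) : Prop := κ⁻¹ * y ≤ x ∧ x ≤ κ * y

namespace Problem

variable {K p : ℕ} (P : Problem K p)

/-- The index set of all `N` observations. -/
abbrev Obs : Type := (k : Fin (K + 1)) × Fin (P.n k)

/-- The responses of all data sets. -/
abbrev Data : Type := (k : Fin (K + 1)) → Fin (P.n k) → ℝ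

/-- Parameters `(β^{(0)}, (δ^{(k)})_k)`. -/
abbrev Param (K p : ℕ) : Type := (Fin p → ℝ) × (Fin K → Fin p → ℝ)

/-- The coefficients `β^{(0)}` and `β^{(k)} = β^{(0)} + δ^{(k)}` of all data sets. -/
def coef (θ : Param K p) : Fin (K + 1) → Fin p → ℝ := Fin.cons θ.1 fun k => θ.1 + θ.2 k

/-- The true parameter. -/
def θstar : Param K p := (P.β, P.δ)

/-- The true signal set `S*`. -/
def Sstar : Finset (Fin p) := {j | P.ζ j ≤ |P.β j|}

/-- The true non-transferable sets `T_k*`. -/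
def Tstar (k : Fin K) : Finset (Fin p) := {j | P.h k j ≤ |P.δ k j|}

/-- The family `(T_k*)` with `T_0 = ∅` for the target. -/
def Tall : Fin (K + 1) → Finset (Fin p) := Fin.cons ∅ P.Tstar

/-- Total sample size. -/
def N : ℕ := ∑ k, P.n k

/-- The covariate-`j`-specific transferable set `{k : j ∈ S \ T_k*}`. -/
def Hj (S : Finset (Fin p)) (j : Fin p) : Finset (Fin K) := {k | j ∈ S \ P.Tstar k}

/-- The sources that have at least one transferable covariate in `S`. -/
def H (S : Finset (Fin p)) : Finset (Fin K) := S.biUnion (P.Hj S)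

/-- The useful sample size for covariate `j`. -/
def nj (S : Finset (Fin p)) (j : Fin p) : ℕ := P.n 0 + ∑ k ∈ P.Hj S j, P.n k.succ

/-- The sample size of the target and of all sources in `H S`. -/
def nS (S : Finset (Fin p)) : ℕ := P.n 0 + ∑ k ∈ P.H S, P.n k.succ

/-- `Q̃_k`: the identity minus the projection onto the columns of `X^{(k)}` in `T_k*`
(the identity for the target). -/
def Qk (k : Fin (K + 1)) : Matrix (Fin (P.n k)) (Fin (P.n k)) ℝ := 1 - proj (P.X k) (P.Tall k)

/-- The transformed design of data set `k`; `Q̃_k` is a projection, hence its own square root. -/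
def Xt (k : Fin (K + 1)) : Matrix (Fin (P.n k)) (Fin p) ℝ := P.Qk k * P.X k

/-- The block diagonal matrix of the `Q̃_k`. -/
def Q : Matrix P.Obs P.Obs ℝ := Matrix.blockDiagonal' P.Qk

/-- The stacked transformed design. -/
def XT : Matrix P.Obs (Fin p) ℝ := Matrix.of fun o j => P.Xt o.1 o.2 j

/-- `Φ_S`. -/
def Phi (S : Finset (Fin p)) : Matrix P.Obs P.Obs ℝ := proj P.XT S

/-- The Gram matrix of the columns in `S` of the transformed designs of the target and of the
sources in `H S`, stacked. -/
def gramH (S : Finset (Fin p)) : Matrix S S ℝ :=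
  ∑ k ∈ insert 0 ((P.H S).image Fin.succ), (cols (P.Xt k) S)ᵀ * cols (P.Xt k) S

/-! ### The assumptions -/

/-- Assumption on the true model. -/
structure TrueModel (c₀ C₁ C₂ : ℝ) : Prop where
  signal : ∀ k, sqNorm (P.X k *ᵥ coef P.θstar k) ≤ C₁ * P.n k * P.σ ^ 2 * Real.log p
  small_signal : sqNorm (colsMulVec P.XT P.Sstarᶜ P.β) ≤ C₂ / 2 * P.σ ^ 2 * Real.log p
  small_contrast : ∑ k : Fin K, sqNorm (colsMulVec (P.Xt k.succ) (P.Tstar k)ᶜ (P.δ k)) ≤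
    C₂ / 2 * P.σ ^ 2 * Real.log p
  informative : ∀ j, c₀ * P.N ≤ P.nj Finset.univ j

/-- The index set of the maximum in the sparse projection condition: triples `(S₁, S₂, j)`. -/
abbrev SparseIdx : Type :=
  {t : Finset (Fin p) × Finset (Fin p) × Fin p //
    t.1.card ≤ t.2.1.card ∧ t.2.1.card ≤ P.Ls ∧ t.2.2 ∈ t.2.1 \ t.1}

/-- Assumption on the designs. -/
structure Design (lam C₃ d₁ d₂ : ℝ) : Prop where
  normalized : ∀ k j, sqNorm (fun i => P.X k i j) = P.n k
  restricted_eigenvalue : ∀ S : Finset (Fin p), S.card ≤ P.Ls →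
    MinEigenvalueGE ((P.nS S : ℝ)⁻¹ • P.gramH S) lam
  target_eigenvalue :
    MinEigenvalueGE ((cols (P.X 0) P.Sstar)ᵀ * cols (P.X 0) P.Sstar) (P.n 0 * lam)
  source_eigenvalue : ∀ k, 1 ≤ (P.Tstar k).card →
    MinEigenvalueGE ((cols (P.X k.succ) (P.Tstar k))ᵀ * cols (P.X k.succ) (P.Tstar k))
      (P.n k.succ * lam)
  sparse_projection :
    ∫ z : P.Obs → ℝ, (⨆ t : P.SparseIdx, 1 / √(P.nj t.1.2.1 t.1.2.2 : ℝ) *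
        |z ⬝ᵥ ((P.Q * (1 - P.Phi t.1.1)) *ᵥ fun o => P.XT o t.1.2.2)|)
      ∂(Measure.pi fun _ => gaussianReal 0 1) ≤ √(C₃ * lam * Real.log p) / 2
  weak_source : ∀ k : Fin K, ∀ j ∉ P.Tstar k,
    d₁ * P.n k.succ ≤ sqNorm (fun i => P.Xt k.succ i j)
  weak_correlation : ∀ S : Finset (Fin p), S.card ≤ P.Ls → ∀ j ∉ S,
    d₁ * d₂ * P.nj S j ≤ (fun o => P.XT o j) ⬝ᵥ ((1 - P.Phi S) *ᵥ fun o => P.XT o j)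

/-- Assumption on the prior. -/
structure Prior (κ r : ℝ) : Prop where
  inclusion : SameOrder κ P.q₀ (p : ℝ)⁻¹
  slab : SameOrder κ (P.nS P.Sstar * P.η ^ 2) (max (P.nS P.Sstar : ℝ) ((p : ℝ) ^ (2 * r)))
  source_slab : ∀ k, κ⁻¹ ≤ P.τ k ^ 2

/-- Assumption of large signals. -/
def LargeSignal (C₁ C₂ lam C₃ d₁ d₂ r : ℝ) : Prop :=
  ∀ j ∈ P.Sstar, 8 * (3 / 2 * C₁ * lam⁻¹ + r + 3 + (C₂ + C₃) / 4) *
    (P.σ ^ 2 * Real.log p / (P.nj P.Sstar j * d₁ * d₂)) ≤ P.ζ j ^ 2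

/-- The coefficients outside `S*` are at most of the order of the estimation error. -/
structure NegligibleTail (κ : ℝ) : Prop where
  l1 : ∑ j ∈ P.Sstarᶜ, |P.β j| ≤
    κ * P.σ * P.Sstar.card * √(Real.log p / P.nS P.Sstar)
  l2 : √(∑ j ∈ P.Sstarᶜ, P.β j ^ 2) ≤
    κ * P.σ * √(P.Sstar.card * Real.log p / P.nS P.Sstar)

/-! ### The posterior -/

/-- The law of the responses under the parameter `θ`: independent Gaussian noise of variance `σ²`
around `X^{(k)} β^{(k)}`. -/
def dataLaw (θ : Param K p) : Measure P.Data :=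
  Measure.pi fun k => Measure.pi fun i =>
    gaussianReal ((P.X k *ᵥ coef θ k) i) (P.σ ^ 2).toNNReal

/-- The likelihood. -/
def likelihood (y : P.Data) (θ : Param K p) : ENNReal :=
  ∏ k, ∏ i, gaussianPDF ((P.X k *ᵥ coef θ k) i) (P.σ ^ 2).toNNReal (y k i)

/-- Independent coordinates: `N(0, v)` for the indices in `D` and the Dirac mass at `0` otherwise. -/
def slabOn (D : Finset (Fin p)) (v : ℝ) : Measure (Fin p → ℝ) :=
  Measure.pi fun j => if j ∈ D then gaussianReal 0 v.toNNReal else Measure.dirac 0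

/-- The spike-and-slab prior of `β^{(0)}`: independent `Bernoulli(q₀)` inclusion indicators,
restricted to the models `S` with `|S| ≤ Ls`. The restriction is not normalized: the constant
cancels in the posterior. -/
def priorβ : Measure (Fin p → ℝ) :=
  ∑ S : Finset (Fin p) with S.card ≤ P.Ls,
    ENNReal.ofReal (P.q₀ ^ S.card * (1 - P.q₀) ^ (p - S.card)) • slabOn S (P.η ^ 2 * P.σ ^ 2)

/-- The prior of the contrasts when the non-transferable sets are known to be the `T_k*`. -/
def priorδ : Measure (Fin K → Fin p → ℝ) :=
  Measure.pi fun k => slabOn (P.Tstar k) (P.τ k ^ 2 * P.σ ^ 2)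

/-- The joint prior. -/
def prior : Measure (Param K p) := P.priorβ.prod P.priorδ

/-- The posterior, by Bayes' formula. -/
def posterior (y : P.Data) : Measure (Param K p) :=
  (∫⁻ θ, P.likelihood y θ ∂P.prior)⁻¹ • P.prior.withDensity (P.likelihood y)

end Problem

end Transfer

end

noncomputable section

namespace Transfer

/-! ### Products of measures -/

/-! The contrasts can be integrated out exactly. Their Gaussian prior on `T_k*` acts like additional
observations, equal to 0, of `δ^{(k)}_j / τ_k`. The marginal likelihood of `β^{(0)}` is therefore a
constant times `exp(-‖W(y - Xβ)‖² / (2σ²))`, where `W` (`whiten`) appends these zeros and projects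
off everything the contrasts can fit. The seminorm `‖W u‖²` dominates `∑ ‖Q̃_k u_k‖²` and exceeds it
by at most `κ ‖u_k‖² / (n_k lam)` per source. The first bound carries the restricted eigenvalue
condition over to `W`, with constant `c₀ lam N`; the second shows that the part of the mean not
explained by the large true coefficients `βlarge` has squared norm `O(σ² s* log p)`.

The posterior is then a quotient of integrals of likelihood ratios relative to `βlarge`. With
probability at least `1 - 5/p` the noise is weakly correlated with all covariates and with all
residuals of regressions of the large signal on models. On that event the log ratio in a model `S`
is at most `O((|S| + s*) log p)` minus a multiple of the squared distance of the fits
(`log_ratio_le`). Integrating what remains against a slab with `N η² ≳ p^{2r}` costs a factor of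
order `p^{-r}` per covariate, and `r ≥ 1 + 8/lam` outweighs what the noise can gain. So models
larger than `A s*` are negligible, smaller ones matter only close to `βlarge`, and the sum over
models converges because `∑_S p^{-|S|} ≤ 3` (`Design.numerator_le`). A tiny box around `βlarge` in
the model `S*` bounds the denominator below by `p^{-C s*}` (`Design.denominator_ge`).

Taking `A` large against all these exponents gives contraction around `βlarge` without any
identification of `S*`; the coefficients outside `S*` only add to the constant `M`. -/

theorem lintegral_fin_prod_eq_prod {n : ℕ} {E : Fin n → Type*} {mE : ∀ i, MeasurableSpace (E i)}
    {μ : (i : Fin n) → Measure (E i)} [∀ i, SigmaFinite (μ i)] (f : (i : Fin n) → E i → ENNReal)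
    (hf : ∀ i, Measurable (f i)) :
    ∫⁻ x : (i : Fin n) → E i, ∏ i, f i (x i) ∂(Measure.pi μ) = ∏ i, ∫⁻ x, f i x ∂(μ i) := by
  induction n with
  | zero => simp
  | succ n n_ih =>
      have hm : Measurable fun x : (i : Fin (n + 1)) → E i => ∏ i, f i (x i) :=
        Finset.measurable_prod _ fun i _ => (hf i).comp (measurable_pi_apply i)
      calc
        _ = ∫⁻ x : E 0 × ((i : Fin n) → E (Fin.succ i)),
            f 0 x.1 * ∏ i : Fin n, f (Fin.succ i) (x.2 i)
            ∂((μ 0).prod (Measure.pi (fun i ↦ μ i.succ))) := by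
          refine (((measurePreserving_piFinSuccAbove μ 0).symm).lintegral_comp hm).symm.trans
            (lintegral_congr fun x => ?_)
          rw [Fin.prod_univ_succ]
          rfl
        _ = (∫⁻ x, f 0 x ∂μ 0)
            * ∏ i : Fin n, ∫⁻ (x : E (Fin.succ i)), f (Fin.succ i) x ∂(μ i.succ) := by
          rw [← n_ih _ (fun i => hf i.succ), ← lintegral_prod_mul (hf 0).aemeasurable
            (Finset.measurable_prod _ fun i _ =>
              (hf i.succ).comp (measurable_pi_apply i)).aemeasurable]
        _ = ∏ i, ∫⁻ x, f i x ∂(μ i) := by rw [Fin.prod_univ_succ]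

theorem lintegral_pi_prod_eq_prod {ι : Type*} [Fintype ι] {E : ι → Type*}
    {mE : ∀ i, MeasurableSpace (E i)} {μ : (i : ι) → Measure (E i)} [∀ i, SigmaFinite (μ i)]
    (f : (i : ι) → E i → ENNReal) (hf : ∀ i, Measurable (f i)) :
    ∫⁻ x : (i : ι) → E i, ∏ i, f i (x i) ∂(Measure.pi μ) = ∏ i, ∫⁻ x, f i x ∂(μ i) := by
  let e := (Fintype.equivFin ι).symm
  have hm : Measurable fun x : (i : ι) → E i => ∏ i, f i (x i) :=
    Finset.measurable_prod _ fun i _ => (hf i).comp (measurable_pi_apply i)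
  rw [← (measurePreserving_piCongrLeft _ e).lintegral_comp hm]
  simp_rw [← e.prod_comp, MeasurableEquiv.coe_piCongrLeft, Equiv.piCongrLeft_apply_apply]
  exact lintegral_fin_prod_eq_prod _ fun i => hf _

/-- A change of variables by translation in each factor gives one for the product. -/
theorem lintegral_pi_add {ι : Type*} [Fintype ι] {E : ι → Type*} [∀ i, MeasurableSpace (E i)]
    [∀ i, Add (E i)] [∀ i, MeasurableAdd (E i)] (μ : (i : ι) → Measure (E i))
    [∀ i, SigmaFinite (μ i)] (m : (i : ι) → E i) (d : (i : ι) → E i → ENNReal)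
    (hd : ∀ i, Measurable (d i))
    (h : ∀ i, ∀ f : E i → ENNReal, Measurable f →
      ∫⁻ x, f (x + m i) * d i x ∂μ i = ∫⁻ x, f x ∂μ i)
    (f : ((i : ι) → E i) → ENNReal) (hf : Measurable f) :
    ∫⁻ x, f (x + m) * ∏ i, d i (x i) ∂Measure.pi μ = ∫⁻ x, f x ∂Measure.pi μ := by
  have hD : Measurable fun x : (i : ι) → E i => ∏ i, d i (x i) :=
    Finset.measurable_prod _ fun i _ => (hd i).comp (measurable_pi_apply i)
  have hT : Measurable fun x : (i : ι) → E i => x + m :=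
    measurable_pi_lambda _ fun i => (measurable_pi_apply i).add_const (m i)
  have key : Measure.pi μ =
      ((Measure.pi μ).withDensity fun x => ∏ i, d i (x i)).map (fun x => x + m) := by
    -- A product measure is determined by its values on boxes, where both the indicator and the
    -- density factorise.
    refine Measure.pi_eq fun s hs => ?_
    have hpi : MeasurableSet (Set.univ.pi s) := MeasurableSet.univ_pi hs
    have hi : Measurable fun x =>
        (Set.univ.pi s).indicator (1 : ((i : ι) → E i) → ENNReal) (x + m) :=
      (measurable_one.indicator hpi).comp hT
    rw [← lintegral_indicator_one hpi, lintegral_map (measurable_one.indicator hpi) hT,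
      lintegral_withDensity_eq_lintegral_mul _ hD hi]
    have : ∀ x : (i : ι) → E i, ((fun x : (i : ι) → E i => ∏ i, d i (x i)) * fun x =>
        (Set.univ.pi s).indicator (1 : ((i : ι) → E i) → ENNReal) (x + m)) x =
        ∏ i, ((s i).indicator (1 : E i → ENNReal) (x i + m i) * d i (x i)) := by
      intro x
      rw [Pi.mul_apply, mul_comm, Finset.prod_mul_distrib]
      congr 1
      by_cases hx : x + m ∈ Set.univ.pi s
      · rw [Set.indicator_of_mem hx, Pi.one_apply]
        refine (Finset.prod_eq_one fun i _ => ?_).symm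
        exact Set.indicator_of_mem (hx i (Set.mem_univ i)) _
      · rw [Set.indicator_of_notMem hx]
        simp only [Set.mem_pi, not_forall] at hx
        obtain ⟨i, _, hi⟩ := hx
        exact (Finset.prod_eq_zero (Finset.mem_univ i) (Set.indicator_of_notMem hi _)).symm
    simp_rw [this]
    rw [lintegral_pi_prod_eq_prod (μ := μ)
      (fun i x => (s i).indicator (1 : E i → ENNReal) (x + m i) * d i x)]
    · refine Finset.prod_congr rfl fun i _ => ?_
      rw [h i _ (measurable_one.indicator (hs i)), lintegral_indicator_one (hs i)]
    · intro i
      exact ((measurable_one.indicator (hs i)).comp (measurable_id.add_const _)).mul (hd i)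
  have hfT : Measurable fun x => f (x + m) := hf.comp hT
  conv_rhs => rw [key]
  rw [lintegral_map hf hT, lintegral_withDensity_eq_lintegral_mul _ hD hfT]
  simp_rw [Pi.mul_apply, mul_comm]

/-! ### One-dimensional Gaussian integrals -/

theorem lintegral_gaussianReal_eq (μ : ℝ) {v : NNReal} (hv : v ≠ 0) (f : ℝ → ENNReal)
    (hf : Measurable f) :
    ∫⁻ x, f x ∂gaussianReal μ v = ∫⁻ x, gaussianPDF μ v x * f x := by
  rw [gaussianReal_of_var_ne_zero _ hv,
    lintegral_withDensity_eq_lintegral_mul _ (measurable_gaussianPDF μ v) hf]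
  rfl

/-- Cameron–Martin in one dimension: the weight is the ratio of the centred density at `x + m` to
that at `x`. -/
theorem lintegral_gaussianReal_add {v : ℝ} (hv : 0 < v) (m : ℝ) (f : ℝ → ENNReal)
    (hf : Measurable f) :
    ∫⁻ x, f (x + m) * ENNReal.ofReal (Real.exp (-(2 * m * x + m ^ 2) / (2 * v)))
      ∂gaussianReal 0 v.toNNReal = ∫⁻ x, f x ∂gaussianReal 0 v.toNNReal := by
  have hv' : v.toNNReal ≠ 0 := by simpa using hv
  have hc : ((v.toNNReal : NNReal) : ℝ) = v := Real.coe_toNNReal v hv.le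
  rw [lintegral_gaussianReal_eq 0 hv' _ (by fun_prop), lintegral_gaussianReal_eq 0 hv' _ hf,
    ← lintegral_add_right_eq_self (fun x => gaussianPDF 0 v.toNNReal x * f x) m]
  refine lintegral_congr fun x => ?_
  rw [mul_left_comm, mul_comm (f _)]
  congr 1
  rw [gaussianPDF, gaussianPDF, ← ENNReal.ofReal_mul (gaussianPDFReal_nonneg _ _ _),
    gaussianPDFReal, gaussianPDFReal, hc, mul_assoc, ← Real.exp_add]
  congr 4
  field_simp
  ring

/-- The slab density is at most its value at 0, and the integrand is an unnormalised `N(c, 1/(2a))`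
density. The bound is uniform in the centre `c`; it is the price of one extra covariate. -/
theorem lintegral_exp_neg_sq_gaussianReal_le {v a : ℝ} (hv : 0 < v) (ha : 0 < a) (c : ℝ) :
    ∫⁻ x, ENNReal.ofReal (Real.exp (-(a * (x - c) ^ 2))) ∂gaussianReal 0 v.toNNReal ≤
      ENNReal.ofReal (√(2 * a * v))⁻¹ := by
  have hv' : v.toNNReal ≠ 0 := by simpa using hv
  have hc : ((v.toNNReal : NNReal) : ℝ) = v := Real.coe_toNNReal v hv.le
  rw [lintegral_gaussianReal_eq 0 hv' _ (by fun_prop)]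
  set w : ℝ := (2 * a)⁻¹ with hw
  have hwp : 0 < w := by positivity
  have hwc : ((w.toNNReal : NNReal) : ℝ) = w := Real.coe_toNNReal w hwp.le
  have hw' : w.toNNReal ≠ 0 := by simpa using hwp
  calc ∫⁻ x, gaussianPDF 0 v.toNNReal x * ENNReal.ofReal (Real.exp (-(a * (x - c) ^ 2)))
      ≤ ∫⁻ x, ENNReal.ofReal (√(2 * a * v))⁻¹ * gaussianPDF c w.toNNReal x := by
        refine lintegral_mono fun x => ?_
        rw [gaussianPDF, gaussianPDF, ← ENNReal.ofReal_mul (gaussianPDFReal_nonneg _ _ _),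
          ← ENNReal.ofReal_mul (by positivity)]
        refine ENNReal.ofReal_le_ofReal ?_
        rw [gaussianPDFReal, gaussianPDFReal, hc, hwc]
        have e1 : (√(2 * Real.pi * v))⁻¹ = (√(2 * a * v))⁻¹ * (√(2 * Real.pi * w))⁻¹ := by
          rw [← mul_inv, ← Real.sqrt_mul (by positivity)]
          congr 2
          rw [hw]; field_simp
        have e2 : -(a * (x - c) ^ 2) = -(x - c) ^ 2 / (2 * w) := by
          rw [hw]; field_simp
        rw [e1, e2, mul_assoc, mul_assoc, mul_assoc]
        refine mul_le_mul_of_nonneg_left (mul_le_mul_of_nonneg_left ?_ (by positivity))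
          (by positivity)
        refine mul_le_of_le_one_left (by positivity) (Real.exp_le_one_iff.mpr ?_)
        have : 0 ≤ (x - 0) ^ 2 / (2 * v) := by positivity
        rw [neg_div]; linarith
    _ = _ := by
        rw [lintegral_const_mul _ (measurable_gaussianPDF _ _), lintegral_gaussianPDF_eq_one _ hw',
          mul_one]

/-- On the interval `x² ≤ 2(c² + ρ²)`, which bounds the density below; the remaining factor is the
length `2ρ`. -/
theorem le_gaussianReal_Icc {v ρ : ℝ} (hv : 0 < v) (c : ℝ) :
    ENNReal.ofReal (2 * ρ * (√(2 * Real.pi * v))⁻¹ * Real.exp (-(c ^ 2 + ρ ^ 2) / v)) ≤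
      gaussianReal 0 v.toNNReal (Set.Icc (c - ρ) (c + ρ)) := by
  have hv' : v.toNNReal ≠ 0 := by simpa using hv
  have hc : ((v.toNNReal : NNReal) : ℝ) = v := Real.coe_toNNReal v hv.le
  rw [gaussianReal_apply _ hv']
  calc _ = ∫⁻ x in Set.Icc (c - ρ) (c + ρ),
        ENNReal.ofReal ((√(2 * Real.pi * v))⁻¹ * Real.exp (-(c ^ 2 + ρ ^ 2) / v)) := by
        rw [setLIntegral_const, Real.volume_Icc, ← ENNReal.ofReal_mul (by positivity)]
        congr 1; ring
    _ ≤ _ := by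
        refine setLIntegral_mono (measurable_gaussianPDF _ _) fun x hx => ?_
        rw [gaussianPDF]
        refine ENNReal.ofReal_le_ofReal ?_
        rw [gaussianPDFReal, hc]
        refine mul_le_mul_of_nonneg_left (Real.exp_le_exp.mpr ?_) (by positivity)
        rw [neg_div, neg_div, neg_le_neg_iff, div_le_div_iff₀ (by positivity) hv]
        have h1 : (x - c) ^ 2 ≤ ρ ^ 2 := by
          refine sq_le_sq' ?_ ?_ <;> linarith [hx.1, hx.2]
        nlinarith [sq_nonneg (x - 2 * c)]

theorem lintegral_exp_mul_sub_gaussianReal {v : ℝ} (hv : 0 < v) (μ s : ℝ) :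
    ∫⁻ x, ENNReal.ofReal (Real.exp (s * (x - μ))) ∂gaussianReal μ v.toNNReal =
      ENNReal.ofReal (Real.exp (s ^ 2 * v / 2)) := by
  have hv' : v.toNNReal ≠ 0 := by simpa using hv
  have hc : ((v.toNNReal : NNReal) : ℝ) = v := Real.coe_toNNReal v hv.le
  rw [lintegral_gaussianReal_eq _ hv' _ (by fun_prop)]
  calc _ = ∫⁻ x, ENNReal.ofReal (Real.exp (s ^ 2 * v / 2)) *
        gaussianPDF (μ + s * v) v.toNNReal x := by
        refine lintegral_congr fun x => ?_
        rw [gaussianPDF, gaussianPDF, ← ENNReal.ofReal_mul (gaussianPDFReal_nonneg _ _ _),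
          ← ENNReal.ofReal_mul (by positivity), gaussianPDFReal, gaussianPDFReal, hc, mul_assoc,
          mul_left_comm (Real.exp _), ← Real.exp_add, ← Real.exp_add]
        congr 3
        field_simp
        ring
    _ = _ := by
        rw [lintegral_const_mul _ (measurable_gaussianPDF _ _), lintegral_gaussianPDF_eq_one _ hv',
          mul_one]

/-! ### Spike-and-slab measures -/

instance isProbabilityMeasure_slab {p : ℕ} (D : Finset (Fin p)) (v : ℝ) (j : Fin p) :
    IsProbabilityMeasure (if j ∈ D then gaussianReal 0 v.toNNReal else Measure.dirac (0 : ℝ)) := by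
  split_ifs <;> infer_instance

instance {p : ℕ} (D : Finset (Fin p)) (v : ℝ) : IsProbabilityMeasure (Problem.slabOn D v) := by
  unfold Problem.slabOn; infer_instance

theorem ae_slabOn {p : ℕ} (D : Finset (Fin p)) (v : ℝ) :
    ∀ᵐ x ∂Problem.slabOn D v, ∀ j, j ∉ D → x j = 0 := by
  rw [ae_all_iff]
  intro j
  by_cases hj : j ∈ D
  · exact Filter.Eventually.of_forall fun x h => absurd hj h
  · have : ∀ᵐ t ∂(if j ∈ D then gaussianReal 0 v.toNNReal else Measure.dirac (0 : ℝ)), t = 0 := by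
      rw [if_neg hj, ae_dirac_eq]; simp
    have h2 := (Measure.quasiMeasurePreserving_eval (μ := fun j : Fin p =>
      if j ∈ D then gaussianReal 0 v.toNNReal else Measure.dirac (0 : ℝ)) j).ae this
    filter_upwards [h2] with x hx _ using hx

theorem lintegral_slabOn_add {p : ℕ} (D : Finset (Fin p)) {v : ℝ} (hv : 0 < v) (m : Fin p → ℝ)
    (hm : ∀ j, j ∉ D → m j = 0) (f : (Fin p → ℝ) → ENNReal) (hf : Measurable f) :
    ∫⁻ x, f (x + m) * ∏ j, ENNReal.ofReal (Real.exp (-(2 * m j * x j + m j ^ 2) / (2 * v)))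
      ∂Problem.slabOn D v = ∫⁻ x, f x ∂Problem.slabOn D v := by
  refine lintegral_pi_add _ m
    (fun j t => ENNReal.ofReal (Real.exp (-(2 * m j * t + m j ^ 2) / (2 * v))))
    (fun j => by fun_prop) (fun j g hg => ?_) f hf
  by_cases hj : j ∈ D
  · simp only [if_pos hj]
    exact lintegral_gaussianReal_add hv (m j) g hg
  -- At a Dirac coordinate `m j = 0`, so there is neither a shift nor a weight.
  · simp [hj, hm j hj]

theorem lintegral_slabOn_exp_le {p : ℕ} (S : Finset (Fin p)) {v a : ℝ} (hv : 0 < v) (ha : 0 < a)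
    (c : Fin p → ℝ) :
    ∫⁻ x, ENNReal.ofReal (Real.exp (-(a * ∑ j ∈ S, (x j - c j) ^ 2))) ∂Problem.slabOn S v ≤
      ENNReal.ofReal ((√(2 * a * v))⁻¹ ^ S.card) := by
  have e : ∀ x : Fin p → ℝ, ENNReal.ofReal (Real.exp (-(a * ∑ j ∈ S, (x j - c j) ^ 2))) =
      ∏ j, if j ∈ S then ENNReal.ofReal (Real.exp (-(a * (x j - c j) ^ 2))) else 1 := by
    intro x
    rw [Finset.prod_ite_mem, Finset.univ_inter, ← ENNReal.ofReal_prod_of_nonneg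
      (fun _ _ => (Real.exp_pos _).le), ← Real.exp_sum, Finset.mul_sum, Finset.sum_neg_distrib]
  simp_rw [e]
  unfold Problem.slabOn
  rw [lintegral_pi_prod_eq_prod
    (fun j t => if j ∈ S then ENNReal.ofReal (Real.exp (-(a * (t - c j) ^ 2))) else 1)
    (fun j => by by_cases hj : j ∈ S <;> simp only [hj, if_true, if_false] <;> fun_prop)]
  calc _ ≤ ∏ j : Fin p, if j ∈ S then ENNReal.ofReal (√(2 * a * v))⁻¹ else 1 := by
        refine Finset.prod_le_prod' fun j _ => ?_
        by_cases hj : j ∈ S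
        · simp only [hj, if_true]
          exact lintegral_exp_neg_sq_gaussianReal_le hv ha (c j)
        · simp [hj]
    _ = _ := by
        rw [Finset.prod_ite_mem, Finset.univ_inter, Finset.prod_const,
          ENNReal.ofReal_pow (by positivity)]

theorem le_slabOn_box {p : ℕ} (S : Finset (Fin p)) {v ρ : ℝ} (hv : 0 < v) (hρ : 0 ≤ ρ)
    (c : Fin p → ℝ) (hc : ∀ j, j ∉ S → c j = 0) :
    ENNReal.ofReal ((2 * ρ * (√(2 * Real.pi * v))⁻¹) ^ S.card *
      Real.exp (-(∑ j, c j ^ 2 + S.card * ρ ^ 2) / v)) ≤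
      Problem.slabOn S v (Set.univ.pi fun j => Set.Icc (c j - ρ) (c j + ρ)) := by
  unfold Problem.slabOn
  rw [Measure.pi_pi]
  calc _ = ∏ j, if j ∈ S then ENNReal.ofReal (2 * ρ * (√(2 * Real.pi * v))⁻¹ *
          Real.exp (-(c j ^ 2 + ρ ^ 2) / v)) else 1 := by
        rw [Finset.prod_ite_mem, Finset.univ_inter,
          ← ENNReal.ofReal_prod_of_nonneg (fun _ _ => by positivity), Finset.prod_mul_distrib,
          Finset.prod_const, ← Real.exp_sum]
        congr 3
        rw [← Finset.sum_div, Finset.sum_neg_distrib, Finset.sum_add_distrib, Finset.sum_const,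
          nsmul_eq_mul]
        congr 3
        refine (Finset.sum_subset (Finset.subset_univ S) fun j _ hj => ?_).symm
        simp [hc j hj]
    _ ≤ _ := by
        refine Finset.prod_le_prod' fun j _ => ?_
        by_cases hj : j ∈ S
        · simp only [hj, if_true]
          exact le_gaussianReal_Icc hv (c j)
        · simp only [hj, if_false]
          rw [Measure.dirac_apply_of_mem]
          simp [hc j hj, hρ]

/-! ### Least squares in an inner product space -/

section LeastSquares

variable {E : Type*} [NormedAddCommGroup E] [InnerProductSpace ℝ E] {p : ℕ}

/-- The linear combination of the vectors `x j` with coefficients `b j`. -/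
def comb (x : Fin p → E) (b : Fin p → ℝ) : E := ∑ j, b j • x j

theorem comb_sub (x : Fin p → E) (b c : Fin p → ℝ) : comb x (b - c) = comb x b - comb x c := by
  simp [comb, sub_smul, Finset.sum_sub_distrib]

theorem inner_comb (x : Fin p → E) (z : E) (b : Fin p → ℝ) :
    inner ℝ z (comb x b) = ∑ j, b j * inner ℝ z (x j) := by
  simp [comb, inner_sum, inner_smul_right]

theorem norm_comb_le (x : Fin p → E) (b : Fin p → ℝ) {n : ℝ} (hx : ∀ j, ‖x j‖ ≤ n) :
    ‖comb x b‖ ≤ (∑ j, |b j|) * n := by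
  rw [Finset.sum_mul]
  refine (norm_sum_le _ _).trans (Finset.sum_le_sum fun j _ => ?_)
  rw [norm_smul, Real.norm_eq_abs]
  exact mul_le_mul_of_nonneg_left (hx j) (abs_nonneg _)

theorem abs_inner_comb_le (x : Fin p → E) (z : E) (b : Fin p → ℝ) {m : ℝ}
    (hz : ∀ j, |inner ℝ z (x j)| ≤ m) : |inner ℝ z (comb x b)| ≤ (∑ j, |b j|) * m := by
  rw [inner_comb, Finset.sum_mul]
  refine (Finset.abs_sum_le_sum_abs _ _).trans (Finset.sum_le_sum fun j _ => ?_)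
  rw [abs_mul]
  exact mul_le_mul_of_nonneg_left (hz j) (abs_nonneg _)

theorem sq_sum_abs_le {S : Finset (Fin p)} {b : Fin p → ℝ} (hb : ∀ j, j ∉ S → b j = 0) :
    (∑ j, |b j|) ^ 2 ≤ S.card * ∑ j, b j ^ 2 := by
  have e1 : ∑ j, |b j| = ∑ j ∈ S, |b j| :=
    (Finset.sum_subset (Finset.subset_univ S) fun j _ hj => by simp [hb j hj]).symm
  have e2 : ∑ j, b j ^ 2 = ∑ j ∈ S, |b j| ^ 2 := by
    simp_rw [sq_abs]
    exact (Finset.sum_subset (Finset.subset_univ S) fun j _ hj => by simp [hb j hj]).symm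
  rw [e1, e2]
  exact sq_sum_le_card_mul_sum_sq

theorem comb_mem_span (x : Fin p → E) (S : Finset (Fin p)) {b : Fin p → ℝ}
    (hb : ∀ j, j ∉ S → b j = 0) : comb x b ∈ Submodule.span ℝ (x '' S) := by
  refine Submodule.sum_mem _ fun j _ => ?_
  by_cases hj : j ∈ S
  · exact Submodule.smul_mem _ _ (Submodule.subset_span ⟨j, hj, rfl⟩)
  · simp [hb j hj]

theorem exists_comb_eq (x : Fin p → E) (S : Finset (Fin p)) {w : E}
    (hw : w ∈ Submodule.span ℝ (x '' S)) :
    ∃ c : Fin p → ℝ, (∀ j, j ∉ S → c j = 0) ∧ comb x c = w := by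
  obtain ⟨c, hc⟩ := (Submodule.mem_span_image_finset_iff_exists_fun ℝ).mp hw
  refine ⟨fun j => if hj : j ∈ S then c ⟨j, hj⟩ else 0, fun j hj => dif_neg hj, ?_⟩
  rw [← hc, comb, ← Finset.sum_subset (Finset.subset_univ S) fun j _ hj => by simp [hj],
    ← Finset.sum_coe_sort S]
  exact Finset.sum_congr rfl fun j _ => by simp

/-- Pythagoras around the best approximation of `w` in `U`. It serves both to complete the square in
the contrasts and to identify the projection as a minimiser. -/
theorem sub_starProjection_add_sq (U : Submodule ℝ E) [U.HasOrthogonalProjection] (w k : E)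
    (hk : k ∈ U) : ‖w - (k + U.starProjection w)‖ ^ 2 = ‖Uᗮ.starProjection w‖ ^ 2 + ‖k‖ ^ 2 := by
  have e : w - (k + U.starProjection w) = Uᗮ.starProjection w - k := by
    rw [Submodule.starProjection_orthogonal_val]; abel
  have o : inner ℝ (Uᗮ.starProjection w) k = 0 :=
    Submodule.inner_left_of_mem_orthogonal hk (Submodule.starProjection_apply_mem _ _)
  rw [e, norm_sub_sq_real, o]
  ring

theorem sq_norm_orthogonal_starProjection_le (U : Submodule ℝ E) [U.HasOrthogonalProjection]
    (w k : E) (hk : k ∈ U) : ‖Uᗮ.starProjection w‖ ^ 2 ≤ ‖w - k‖ ^ 2 := by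
  have h := sub_starProjection_add_sq U w (k - U.starProjection w)
    (U.sub_mem hk (Submodule.starProjection_apply_mem _ _))
  rw [sub_add_cancel] at h
  rw [h]
  exact le_add_of_nonneg_right (sq_nonneg _)

/-- For the denominator: near the reference point crude bounds suffice, with the bias term absorbed
by `2⟨v, x⟩ ≥ -‖v‖² - ‖x‖²`. -/
theorem le_log_ratio (x : Fin p → E) (z v : E) {m n ρ : ℝ}
    (hz : ∀ j, |inner ℝ z (x j)| ≤ m) (hx : ∀ j, ‖x j‖ ≤ n) (hm : 0 ≤ m) (hn : 0 ≤ n)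
    (b : Fin p → ℝ) (hb : ∑ j, |b j| ≤ ρ) :
    -(2 * (ρ * m) + ‖v‖ ^ 2 + 2 * (ρ * n) ^ 2) ≤
      2 * inner ℝ (z + v) (comb x b) - ‖comb x b‖ ^ 2 := by
  have h1 := abs_inner_comb_le x z b hz
  have h2 := norm_comb_le x b hx
  have h3 : (∑ j, |b j|) * m ≤ ρ * m := mul_le_mul_of_nonneg_right hb hm
  have h4 : (∑ j, |b j|) * n ≤ ρ * n := mul_le_mul_of_nonneg_right hb hn
  have h5 := (abs_le.mp h1).1
  have h6 := (abs_le.mp (abs_real_inner_le_norm v (comb x b))).1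
  have h7 : ‖comb x b‖ ^ 2 ≤ (ρ * n) ^ 2 := pow_le_pow_left₀ (norm_nonneg _) (h2.trans h4) 2
  rw [inner_add_left]
  nlinarith [sq_nonneg (‖v‖ - ‖comb x b‖)]

variable [FiniteDimensional ℝ E]

/-- The residual of the regression of `w` on the `x j`, `j ∈ S`. -/
def residual (x : Fin p → E) (S : Finset (Fin p)) (w : E) : E :=
  (Submodule.span ℝ (x '' S))ᗮ.starProjection w

/-- The weights of this arithmetic-geometric inequality leave room in the log ratio: the noise uses
`3/4` of the negative square and the bias `1/8`, so `1/8` survives. -/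
theorem two_mul_le_of_sq_le {a R X : ℝ} (hR : 0 ≤ R) (hX : 0 ≤ X) (h : a ^ 2 ≤ R * X) :
    2 * a ≤ 4 / 3 * R + 3 / 4 * X := by
  refine le_of_abs_le (abs_le_of_sq_le_sq ?_ (by positivity))
  nlinarith [sq_nonneg (4 / 3 * R - 3 / 4 * X)]

/-- Upper bound of a Gaussian log likelihood ratio in a sparse model, from a bound on the
correlations of the noise `z` with the covariates and with the residual of the truth. -/
theorem log_ratio_le (x : Fin p → E) (βb : Fin p → ℝ) (z v : E) (S : Finset (Fin p))
    {Lam m τ : ℝ} (hLam : 0 < Lam)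
    (hRE : ∀ b : Fin p → ℝ, (∀ j, j ∉ S → b j = 0) → Lam * ∑ j, b j ^ 2 ≤ ‖comb x b‖ ^ 2)
    (hz : ∀ j, |inner ℝ z (x j)| ≤ m)
    (hr : inner ℝ z (-residual x S (comb x βb)) ≤ ‖residual x S (comb x βb)‖ * τ) :
    ∃ c : Fin p → ℝ, ∀ β : Fin p → ℝ, (∀ j, j ∉ S → β j = 0) →
      2 * inner ℝ (z + v) (comb x (β - βb)) - ‖comb x (β - βb)‖ ^ 2 ≤
        4 / 3 * (m ^ 2 * S.card / Lam + τ ^ 2) + 8 * ‖v‖ ^ 2 - ‖comb x (β - βb)‖ ^ 2 / 8 ∧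
      Lam * ∑ j ∈ S, (β j - c j) ^ 2 ≤ ‖comb x (β - βb)‖ ^ 2 := by
  set w := comb x βb with hw
  set U := Submodule.span ℝ (x '' S) with hU
  set r := residual x S w with hrdef
  -- `c` holds the coefficients of the projection of the truth onto the model. It does not depend on
  -- `β`, so the later integral over `β` has a fixed centre.
  obtain ⟨c, hc0, hc⟩ := exists_comb_eq x S (Submodule.starProjection_apply_mem U w)
  refine ⟨c, fun β hβ => ?_⟩
  have hd0 : ∀ j, j ∉ S → (β - c) j = 0 := fun j hj => by simp [hβ j hj, hc0 j hj]
  have hd : comb x (β - βb) = comb x (β - c) - r := by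
    rw [comb_sub, comb_sub, hc, hrdef, residual, Submodule.starProjection_orthogonal_val]
    abel
  have ho : inner ℝ (comb x (β - c)) r = 0 := by
    rw [real_inner_comm]
    exact Submodule.inner_left_of_mem_orthogonal (comb_mem_span x S hd0)
      (Submodule.starProjection_apply_mem _ _)
  have hx : ‖comb x (β - βb)‖ ^ 2 = ‖comb x (β - c)‖ ^ 2 + ‖r‖ ^ 2 := by
    rw [hd, norm_sub_sq_real, ho]; ring
  have hRE' := hRE _ hd0
  have hsum : ∑ j, (β - c) j ^ 2 = ∑ j ∈ S, (β j - c j) ^ 2 :=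
    (Finset.sum_subset (Finset.subset_univ S) fun j _ hj => by simp [hd0 j hj]).symm
  have hm0 : 0 ≤ (∑ j, |(β - c) j|) := Finset.sum_nonneg fun _ _ => abs_nonneg _
  -- The noise inside the model: Hölder against the largest correlation `m`, then Cauchy–Schwarz on
  -- the support `S`, then the restricted eigenvalue.
  have h1 : 2 * inner ℝ z (comb x (β - c)) ≤
      4 / 3 * (m ^ 2 * S.card / Lam) + 3 / 4 * ‖comb x (β - c)‖ ^ 2 := by
    refine two_mul_le_of_sq_le (by positivity) (by positivity) ?_
    calc inner ℝ z (comb x (β - c)) ^ 2 ≤ ((∑ j, |(β - c) j|) * m) ^ 2 := by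
          rw [← sq_abs]
          exact pow_le_pow_left₀ (abs_nonneg _) (abs_inner_comb_le x z _ hz) 2
      _ = m ^ 2 * (∑ j, |(β - c) j|) ^ 2 := by ring
      _ ≤ m ^ 2 * (S.card * ∑ j, (β - c) j ^ 2) :=
          mul_le_mul_of_nonneg_left (sq_sum_abs_le hd0) (sq_nonneg _)
      _ = m ^ 2 * S.card / Lam * (Lam * ∑ j, (β - c) j ^ 2) := by field_simp
      _ ≤ _ := mul_le_mul_of_nonneg_left hRE' (by positivity)
  -- The residual `r` is one fixed direction per model, so a scalar tail bound handles it, whatever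
  -- the size of the missed signal.
  have h2 : 2 * inner ℝ z (-r) ≤ 4 / 3 * τ ^ 2 + 3 / 4 * ‖r‖ ^ 2 := by
    have := two_mul_le_of_sq_le (a := ‖r‖ * τ) (sq_nonneg τ) (sq_nonneg ‖r‖)
      (by rw [mul_pow, mul_comm])
    linarith
  have h3 : 2 * inner ℝ v (comb x (β - βb)) ≤ 8 * ‖v‖ ^ 2 + ‖comb x (β - βb)‖ ^ 2 / 8 := by
    have := real_inner_le_norm v (comb x (β - βb))
    nlinarith [sq_nonneg (8 * ‖v‖ - ‖comb x (β - βb)‖)]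
  have h4 : inner ℝ z (comb x (β - βb)) = inner ℝ z (comb x (β - c)) + inner ℝ z (-r) := by
    rw [hd, ← inner_add_right, sub_eq_add_neg]
  refine ⟨?_, ?_⟩
  · rw [inner_add_left, h4]
    rw [hx] at h3 ⊢
    linarith
  · rw [hx, ← hsum]
    nlinarith [sq_nonneg ‖r‖]

end LeastSquares

/-! ### Projections onto columns -/

section Proj

variable {ι : Type*} {p : ℕ}

theorem colsMulVec_eq (A : Matrix ι (Fin p) ℝ) (D : Finset (Fin p)) (v : Fin p → ℝ) :
    colsMulVec A D v = A *ᵥ fun j => if j ∈ D then v j else 0 := by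
  ext i
  simp only [colsMulVec, cols, Matrix.mulVec, dotProduct, Matrix.submatrix_apply, id, mul_ite,
    mul_zero, Finset.sum_ite_mem, Finset.univ_inter]
  exact Finset.sum_coe_sort D fun j => A i j * v j

theorem cols_mulVec_restrict (A : Matrix ι (Fin p) ℝ) (D : Finset (Fin p)) {b : Fin p → ℝ}
    (hb : ∀ j, j ∉ D → b j = 0) : (cols A D *ᵥ fun j => b j) = A *ᵥ b := by
  rw [← colsMulVec, colsMulVec_eq]
  congr 1
  ext j
  by_cases hj : j ∈ D <;> simp [hj, hb]

variable [Fintype ι]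

theorem sqNorm_eq_dotProduct (v : ι → ℝ) : sqNorm v = v ⬝ᵥ v := by
  simp [sqNorm, dotProduct, sq]

theorem sqNorm_nonneg (v : ι → ℝ) : 0 ≤ sqNorm v := Finset.sum_nonneg fun _ _ => sq_nonneg _

theorem sqNorm_add_le (v w : ι → ℝ) : sqNorm (v + w) ≤ 2 * sqNorm v + 2 * sqNorm w := by
  simp only [sqNorm, Finset.mul_sum, ← Finset.sum_add_distrib]
  exact Finset.sum_le_sum fun i _ => by
    simp only [Pi.add_apply]; nlinarith [sq_nonneg (v i - w i)]

theorem sqNorm_sub_le (v w : ι → ℝ) : sqNorm (v - w) ≤ 2 * sqNorm v + 2 * sqNorm w := by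
  simp only [sqNorm, Finset.mul_sum, ← Finset.sum_add_distrib]
  exact Finset.sum_le_sum fun i _ => by
    simp only [Pi.sub_apply]; nlinarith [sq_nonneg (v i + w i)]

theorem sum_restrict_sq (D : Finset (Fin p)) {b : Fin p → ℝ} (hb : ∀ j, j ∉ D → b j = 0) :
    ∑ j : D, b j ^ 2 = ∑ j, b j ^ 2 := by
  rw [Finset.sum_coe_sort D fun j => b j ^ 2]
  exact Finset.sum_subset (Finset.subset_univ D) fun j _ hj => by simp [hb j hj]

theorem MinEigenvalueGE.le_dotProduct {n : Type*} [Fintype n] [DecidableEq n]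
    {A : Matrix n n ℝ} {c : ℝ} (h : MinEigenvalueGE A c) (b : n → ℝ) :
    c * ∑ j, b j ^ 2 ≤ b ⬝ᵥ (A *ᵥ b) := by
  have := h.dotProduct_mulVec_nonneg b
  rw [star_trivial, Matrix.sub_mulVec, dotProduct_sub, Matrix.smul_mulVec, Matrix.one_mulVec,
    dotProduct_smul, smul_eq_mul, ← sqNorm_eq_dotProduct] at this
  exact sub_nonneg.mp this

theorem sqNorm_mulVec_eq {n : Type*} [Fintype n] (C : Matrix ι n ℝ) (b : n → ℝ) :
    sqNorm (C *ᵥ b) = b ⬝ᵥ ((Cᵀ * C) *ᵥ b) := by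
  rw [sqNorm_eq_dotProduct, ← Matrix.mulVec_mulVec, Matrix.dotProduct_mulVec,
    ← Matrix.mulVec_transpose, dotProduct_comm]

theorem MinEigenvalueGE.le_sqNorm {X : Matrix ι (Fin p) ℝ} {D : Finset (Fin p)} {c : ℝ}
    (h : MinEigenvalueGE ((cols X D)ᵀ * cols X D) c) {b : Fin p → ℝ}
    (hb : ∀ j, j ∉ D → b j = 0) : c * ∑ j, b j ^ 2 ≤ sqNorm (X *ᵥ b) := by
  rw [← cols_mulVec_restrict X D hb, sqNorm_mulVec_eq, ← sum_restrict_sq D hb]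
  exact h.le_dotProduct _

variable {X : Matrix ι (Fin p) ℝ} {D : Finset (Fin p)} {c : ℝ}

/-- A positive lower bound makes the Gram matrix positive definite, so the `⁻¹` in `proj` is a
genuine inverse and `proj` a genuine projection. -/
theorem MinEigenvalueGE.isUnit_det (hc : 0 < c)
    (h : MinEigenvalueGE ((cols X D)ᵀ * cols X D) c) : IsUnit ((cols X D)ᵀ * cols X D).det := by
  have h2 : ((cols X D)ᵀ * cols X D).PosDef := by
    have := (Matrix.PosDef.one (n := D) (R := ℝ)).smul hc
    simpa using this.posSemidef_add h
  exact (Matrix.isUnit_iff_isUnit_det _).mp h2.isUnit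

variable [DecidableEq ι]

theorem one_sub_proj_mulVec (hc : 0 < c) (h : MinEigenvalueGE ((cols X D)ᵀ * cols X D) c)
    {b : Fin p → ℝ} (hb : ∀ j, j ∉ D → b j = 0) : (1 - proj X D) *ᵥ (X *ᵥ b) = 0 := by
  rw [← cols_mulVec_restrict X D hb, Matrix.mulVec_mulVec, Matrix.sub_mul, proj, Matrix.mul_assoc,
    Matrix.mul_assoc, Matrix.nonsing_inv_mul _ (h.isUnit_det hc)]
  simp

/-- Least squares: the fit is `proj X D *ᵥ w`. -/
theorem exists_proj_mulVec (hc : 0 < c) (h : MinEigenvalueGE ((cols X D)ᵀ * cols X D) c)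
    (w : ι → ℝ) : ∃ a : Fin p → ℝ, (∀ j, j ∉ D → a j = 0) ∧ X *ᵥ a = proj X D *ᵥ w ∧
      sqNorm (X *ᵥ a) + sqNorm ((1 - proj X D) *ᵥ w) = sqNorm w ∧
      c * ∑ j, a j ^ 2 ≤ sqNorm w := by
  set G := (cols X D)ᵀ * cols X D with hG
  set a' : D → ℝ := (G⁻¹ * (cols X D)ᵀ) *ᵥ w with ha'
  set a : Fin p → ℝ := fun j => if hj : j ∈ D then a' ⟨j, hj⟩ else 0 with ha
  have ha0 : ∀ j, j ∉ D → a j = 0 := fun j hj => dif_neg hj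
  have hres : (fun j : D => a j) = a' := by ext j; simp [ha]
  have hfit : X *ᵥ a = proj X D *ᵥ w := by
    rw [← cols_mulVec_restrict X D ha0, hres, ha', Matrix.mulVec_mulVec, proj, Matrix.mul_assoc]
  have ho : (X *ᵥ a) ⬝ᵥ ((1 - proj X D) *ᵥ w) = 0 := by
    have hsym : (proj X D)ᵀ = proj X D := by
      simp only [proj, Matrix.transpose_mul, Matrix.transpose_transpose,
        Matrix.transpose_nonsing_inv, Matrix.mul_assoc]
    rw [Matrix.dotProduct_mulVec, ← Matrix.mulVec_transpose, Matrix.transpose_sub, hsym,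
      Matrix.transpose_one, one_sub_proj_mulVec hc h ha0, zero_dotProduct]
  have hpyth : sqNorm (X *ᵥ a) + sqNorm ((1 - proj X D) *ᵥ w) = sqNorm w := by
    have hw : w = X *ᵥ a + (1 - proj X D) *ᵥ w := by
      rw [hfit, Matrix.sub_mulVec, Matrix.one_mulVec]; abel
    conv_rhs => rw [hw]
    rw [sqNorm_eq_dotProduct (_ + _), add_dotProduct, dotProduct_add, dotProduct_add, ho,
      dotProduct_comm ((1 - proj X D) *ᵥ w) (X *ᵥ a), ho, sqNorm_eq_dotProduct,
      sqNorm_eq_dotProduct]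
    ring
  refine ⟨a, ha0, hfit, hpyth, (h.le_sqNorm ha0).trans ?_⟩
  linarith [sqNorm_nonneg ((1 - proj X D) *ᵥ w)]

theorem sqNorm_one_sub_proj_mulVec_le (hc : 0 < c)
    (h : MinEigenvalueGE ((cols X D)ᵀ * cols X D) c) (w : ι → ℝ) :
    sqNorm ((1 - proj X D) *ᵥ w) ≤ sqNorm w := by
  obtain ⟨a, -, -, ha, -⟩ := exists_proj_mulVec hc h w
  linarith [sqNorm_nonneg (X *ᵥ a)]

end Proj

namespace Problem

variable {K p : ℕ} (P : Problem K p)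

/-! ### Integrating out the contrasts -/

/-- The space of observations and pseudo-observations: the Gaussian prior of a contrast
`δ^{(k)}_j` acts as an observation `0` of `δ^{(k)}_j / τ_k`. -/
abbrev Aug : Type := EuclideanSpace ℝ (P.Obs ⊕ (Fin K × Fin p))

/-- The restriction of the contrasts to the `T_k*`. -/
def mask (δ : Fin K → Fin p → ℝ) (k : Fin K) (j : Fin p) : ℝ :=
  if j ∈ P.Tstar k then δ k j else 0

/-- The restricted contrasts of all data sets, the target having contrast `0`. -/
def contrast (δ : Fin K → Fin p → ℝ) : Fin (K + 1) → Fin p → ℝ := Fin.cons 0 (P.mask δ)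

/-- The contribution of the restricted contrasts to the means. -/
def contrastFit (δ : Fin K → Fin p → ℝ) (o : P.Obs) : ℝ := (P.X o.1 *ᵥ P.contrast δ o.1) o.2

/-- The contribution of `β^{(0)}` to the means. -/
def fit (β : Fin p → ℝ) (o : P.Obs) : ℝ := (P.X o.1 *ᵥ β) o.2

/-- The observations, augmented by zeros. -/
def lift : (P.Obs → ℝ) →ₗ[ℝ] P.Aug where
  toFun u := WithLp.toLp 2 (Sum.elim u 0)
  map_add' u v := by ext (o | o) <;> simp
  map_smul' c u := by ext (o | o) <;> simp

theorem mask_add (δ δ' : Fin K → Fin p → ℝ) : P.mask (δ + δ') = P.mask δ + P.mask δ' := by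
  ext k j; by_cases h : j ∈ P.Tstar k <;> simp [mask, h]

theorem mask_smul (c : ℝ) (δ : Fin K → Fin p → ℝ) : P.mask (c • δ) = c • P.mask δ := by
  ext k j; by_cases h : j ∈ P.Tstar k <;> simp [mask, h]

theorem mask_mask (δ : Fin K → Fin p → ℝ) : P.mask (P.mask δ) = P.mask δ := by
  ext k j; by_cases h : j ∈ P.Tstar k <;> simp [mask, h]

theorem mask_eq_self {δ : Fin K → Fin p → ℝ} (h : ∀ k j, j ∉ P.Tstar k → δ k j = 0) :
    P.mask δ = δ := by
  ext k j; by_cases hj : j ∈ P.Tstar k <;> simp [mask, hj, h]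

theorem contrast_add (δ δ' : Fin K → Fin p → ℝ) :
    P.contrast (δ + δ') = P.contrast δ + P.contrast δ' := by
  ext k j
  refine Fin.cases ?_ (fun k => ?_) k <;> simp [contrast, mask_add]

theorem contrast_smul (c : ℝ) (δ : Fin K → Fin p → ℝ) :
    P.contrast (c • δ) = c • P.contrast δ := by
  ext k j
  refine Fin.cases ?_ (fun k => ?_) k <;> simp [contrast, mask_smul]

/-- The linear map of the contrasts to the augmented observations. -/
def contrastMap : (Fin K → Fin p → ℝ) →ₗ[ℝ] P.Aug where
  toFun δ := WithLp.toLp 2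
    (Sum.elim (P.contrastFit δ) fun q => P.mask δ q.1 q.2 / P.τ q.1)
  map_add' δ δ' := by
    ext (o | o)
    · simp [contrastFit, contrast_add, Matrix.mulVec_add]
    · simp [mask_add, add_div]
  map_smul' c δ := by
    ext (o | o)
    · simp [contrastFit, contrast_smul, Matrix.mulVec_smul]
    · simp [mask_smul, mul_div_assoc]

theorem contrastMap_mask (δ : Fin K → Fin p → ℝ) : P.contrastMap (P.mask δ) = P.contrastMap δ := by
  have h : P.contrastFit (P.mask δ) = P.contrastFit δ := by
    ext o; rw [contrastFit, contrastFit, contrast, contrast, mask_mask]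
  simp only [contrastMap, LinearMap.coe_mk, AddHom.coe_mk, h, mask_mask]

/-- The observations in the geometry in which the contrasts have been integrated out. -/
def whiten : (P.Obs → ℝ) →ₗ[ℝ] P.Aug :=
  ((LinearMap.range P.contrastMap)ᗮ.starProjection : P.Aug →L[ℝ] P.Aug).toLinearMap ∘ₗ P.lift

theorem sq_norm_lift_sub (u : P.Obs → ℝ) (δ : Fin K → Fin p → ℝ) :
    ‖P.lift u - P.contrastMap δ‖ ^ 2 =
      ∑ o, (u o - P.contrastFit δ o) ^ 2 + ∑ k, ∑ j, P.mask δ k j ^ 2 / P.τ k ^ 2 := by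
  rw [EuclideanSpace.real_norm_sq_eq, Fintype.sum_sum_type, Fintype.sum_prod_type]
  simp [lift, contrastMap, div_pow]

theorem sq_norm_contrastMap (δ : Fin K → Fin p → ℝ) :
    ‖P.contrastMap δ‖ ^ 2 =
      ∑ o, P.contrastFit δ o ^ 2 + ∑ k, ∑ j, P.mask δ k j ^ 2 / P.τ k ^ 2 := by
  have := P.sq_norm_lift_sub 0 δ
  rwa [map_zero, zero_sub, norm_neg, show (∑ o, ((0 : P.Obs → ℝ) o - P.contrastFit δ o) ^ 2) =
    ∑ o, P.contrastFit δ o ^ 2 by simp] at this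

theorem sq_norm_whiten_le (u : P.Obs → ℝ) (δ : Fin K → Fin p → ℝ) :
    ‖P.whiten u‖ ^ 2 ≤
      ∑ o, (u o - P.contrastFit δ o) ^ 2 + ∑ k, ∑ j, P.mask δ k j ^ 2 / P.τ k ^ 2 := by
  rw [← sq_norm_lift_sub]
  exact sq_norm_orthogonal_starProjection_le _ _ _ (LinearMap.mem_range_self _ δ)

/-- `m` is the best contrast for the penalised least-squares problem with data `u`. Masking it
changes nothing in `contrastMap` and makes it an admissible shift of the prior. -/
theorem exists_minimizer (u : P.Obs → ℝ) : ∃ m : Fin K → Fin p → ℝ, P.mask m = m ∧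
    ∀ δ, ‖P.lift u - P.contrastMap (δ + m)‖ ^ 2 = ‖P.whiten u‖ ^ 2 + ‖P.contrastMap δ‖ ^ 2 := by
  obtain ⟨m, hm⟩ := Submodule.starProjection_apply_mem (LinearMap.range P.contrastMap) (P.lift u)
  refine ⟨P.mask m, P.mask_mask m, fun δ => ?_⟩
  rw [map_add, contrastMap_mask, hm]
  exact sub_starProjection_add_sq _ _ _ (LinearMap.mem_range_self _ δ)

theorem measurable_mask : Measurable P.mask := by
  refine measurable_pi_lambda _ fun k => measurable_pi_lambda _ fun j => ?_
  unfold mask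
  split_ifs <;> fun_prop

theorem measurable_contrastFit (o : P.Obs) : Measurable fun δ => P.contrastFit δ o := by
  unfold contrastFit Matrix.mulVec dotProduct contrast
  refine Finset.measurable_sum _ fun j _ => Measurable.const_mul ?_ _
  obtain ⟨k, i⟩ := o
  induction k using Fin.cases with
  | zero => simp
  | succ k =>
    simp only [Fin.cons_succ]
    exact (measurable_pi_apply j).comp ((measurable_pi_apply k).comp P.measurable_mask)

instance : IsProbabilityMeasure P.priorδ := by unfold priorδ; infer_instance

theorem slab_var_pos (k : Fin K) : 0 < P.τ k ^ 2 * P.σ ^ 2 :=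
  mul_pos (pow_pos (P.τ_pos k) 2) (pow_pos P.σ_pos 2)

theorem lintegral_priorδ_add {m : Fin K → Fin p → ℝ} (hm : P.mask m = m)
    (f : (Fin K → Fin p → ℝ) → ENNReal) (hf : Measurable f) :
    ∫⁻ δ, f (δ + m) * ∏ k, ∏ j, ENNReal.ofReal
      (Real.exp (-(2 * m k j * δ k j + m k j ^ 2) / (2 * (P.τ k ^ 2 * P.σ ^ 2)))) ∂P.priorδ =
      ∫⁻ δ, f δ ∂P.priorδ := by
  refine lintegral_pi_add _ m (fun k x => ∏ j, ENNReal.ofReal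
    (Real.exp (-(2 * m k j * x j + m k j ^ 2) / (2 * (P.τ k ^ 2 * P.σ ^ 2)))))
    (fun k => by fun_prop) (fun k g hg => ?_) f hf
  refine lintegral_slabOn_add _ (P.slab_var_pos k) (m k) (fun j hj => ?_) g hg
  rw [← hm, mask, if_neg hj]

/-- The Gaussian integral over the contrasts. -/
theorem lintegral_priorδ_exp (u : P.Obs → ℝ) :
    ∫⁻ δ, ENNReal.ofReal (Real.exp (-(∑ o, (u o - P.contrastFit δ o) ^ 2) / (2 * P.σ ^ 2)))
      ∂P.priorδ =
    ENNReal.ofReal (Real.exp (-‖P.whiten u‖ ^ 2 / (2 * P.σ ^ 2))) *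
      ∫⁻ δ, ENNReal.ofReal (Real.exp (-(∑ o, P.contrastFit δ o ^ 2) / (2 * P.σ ^ 2)))
        ∂P.priorδ := by
  have hmeas := P.measurable_contrastFit
  obtain ⟨m, hm, hmin⟩ := P.exists_minimizer u
  -- Recentre the prior at the minimiser. By Pythagoras the exponents then agree pointwise in `δ`,
  -- with no determinant to compute.
  rw [← P.lintegral_priorδ_add hm _ (by fun_prop), ← lintegral_const_mul _ (by fun_prop)]
  refine lintegral_congr fun δ => ?_
  simp_rw [← ENNReal.ofReal_prod_of_nonneg (fun _ _ => (Real.exp_pos _).le)]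
  rw [← ENNReal.ofReal_prod_of_nonneg
    (fun _ _ => Finset.prod_nonneg fun _ _ => (Real.exp_pos _).le)]
  simp_rw [← Real.exp_sum]
  rw [← ENNReal.ofReal_mul (Real.exp_pos _).le, ← ENNReal.ofReal_mul (Real.exp_pos _).le,
    ← Real.exp_add, ← Real.exp_add]
  congr 2
  have h1 := hmin δ
  rw [sq_norm_lift_sub, sq_norm_contrastMap] at h1
  -- The weight of the translation is exactly the change in the penalty of the pseudo-observations.
  have h2 : ∑ k, ∑ j, -(2 * m k j * δ k j + m k j ^ 2) / (2 * (P.τ k ^ 2 * P.σ ^ 2)) =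
      (∑ k, ∑ j, P.mask δ k j ^ 2 / P.τ k ^ 2 - ∑ k, ∑ j, P.mask (δ + m) k j ^ 2 / P.τ k ^ 2) /
        (2 * P.σ ^ 2) := by
    rw [← Finset.sum_sub_distrib, Finset.sum_div]
    refine Finset.sum_congr rfl fun k _ => ?_
    rw [← Finset.sum_sub_distrib, Finset.sum_div]
    refine Finset.sum_congr rfl fun j _ => ?_
    have := P.τ_pos k
    have := P.σ_pos
    have hmk : m k j = P.mask m k j := by rw [hm]
    rw [mask_add, hm]
    have h3 : m k j * δ k j = m k j * P.mask δ k j := by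
      rw [hmk, mask, mask]; split_ifs <;> simp
    rw [mul_assoc, h3, Pi.add_apply, Pi.add_apply]
    field_simp
    ring
  rw [h2, ← add_div, ← add_div]
  congr 1
  linarith

/-! ### The posterior of the target coefficients -/

/-- The observations as a vector, minus the contribution of `β^{(0)}`. -/
def resid (y : P.Data) (β : Fin p → ℝ) (o : P.Obs) : ℝ := y o.1 o.2 - P.fit β o

theorem coef_apply (β : Fin p → ℝ) {δ : Fin K → Fin p → ℝ}
    (hδ : ∀ k j, j ∉ P.Tstar k → δ k j = 0) (k : Fin (K + 1)) :
    coef (β, δ) k = β + P.contrast δ k := by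
  refine Fin.cases ?_ (fun k => ?_) k <;> simp [contrast, coef, P.mask_eq_self hδ]

theorem likelihood_eq (y : P.Data) (β : Fin p → ℝ) {δ : Fin K → Fin p → ℝ}
    (hδ : ∀ k j, j ∉ P.Tstar k → δ k j = 0) :
    P.likelihood y (β, δ) = ENNReal.ofReal ((√(2 * Real.pi * P.σ ^ 2))⁻¹ ^ Fintype.card P.Obs) *
      ENNReal.ofReal (Real.exp
        (-(∑ o, (P.resid y β o - P.contrastFit δ o) ^ 2) / (2 * P.σ ^ 2))) := by
  have hc : (((P.σ ^ 2).toNNReal : NNReal) : ℝ) = P.σ ^ 2 := Real.coe_toNNReal _ (sq_nonneg _)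
  rw [likelihood, ← Fintype.prod_sigma' (fun k i =>
    gaussianPDF ((P.X k *ᵥ coef (β, δ) k) i) (P.σ ^ 2).toNNReal (y k i)),
    ← ENNReal.ofReal_mul (by positivity), neg_div, Finset.sum_div, ← Finset.sum_neg_distrib,
    Real.exp_sum, Fintype.card, ← Finset.prod_const, ← Finset.prod_mul_distrib,
    ENNReal.ofReal_prod_of_nonneg (fun _ _ => by positivity)]
  refine Finset.prod_congr rfl fun o _ => ?_
  rw [gaussianPDF, gaussianPDFReal, hc, P.coef_apply β hδ, Matrix.mulVec_add, Pi.add_apply,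
    resid, fit, contrastFit, neg_div]
  congr 5
  ring

theorem ae_priorδ : ∀ᵐ δ ∂P.priorδ, ∀ k j, j ∉ P.Tstar k → δ k j = 0 := by
  rw [ae_all_iff]
  intro k
  exact (Measure.quasiMeasurePreserving_eval (μ := fun k : Fin K =>
    slabOn (P.Tstar k) (P.τ k ^ 2 * P.σ ^ 2)) k).ae (ae_slabOn (P.Tstar k) (P.τ k ^ 2 * P.σ ^ 2))

/-- The likelihood ratio statistic with the contrasts integrated out. -/
def profile (y : P.Data) (β : Fin p → ℝ) : ENNReal :=
  ENNReal.ofReal (Real.exp (-‖P.whiten (P.resid y β)‖ ^ 2 / (2 * P.σ ^ 2)))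

/-- `Z` depends on neither `y` nor `β`, so it cancels in the posterior; being nonzero and finite is
what permits this. -/
theorem exists_marginal : ∃ Z : ENNReal, Z ≠ 0 ∧ Z ≠ ⊤ ∧ ∀ y β,
    ∫⁻ δ, P.likelihood y (β, δ) ∂P.priorδ = Z * P.profile y β := by
  have hmeas := P.measurable_contrastFit
  have hσ := P.σ_pos
  refine ⟨ENNReal.ofReal ((√(2 * Real.pi * P.σ ^ 2))⁻¹ ^ Fintype.card P.Obs) *
    ∫⁻ δ, ENNReal.ofReal (Real.exp (-(∑ o, P.contrastFit δ o ^ 2) / (2 * P.σ ^ 2)))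
        ∂P.priorδ, mul_ne_zero ?_ ?_, ENNReal.mul_ne_top ENNReal.ofReal_ne_top ?_, fun y β => ?_⟩
  · rw [Ne, ENNReal.ofReal_eq_zero, not_le]
    positivity
  · rw [Ne, lintegral_eq_zero_iff (by fun_prop)]
    intro h
    obtain ⟨δ, hδ⟩ := h.exists
    rw [Pi.zero_apply, ENNReal.ofReal_eq_zero] at hδ
    exact absurd (Real.exp_pos _) (not_lt.mpr hδ)
  · refine ne_top_of_le_ne_top ENNReal.one_ne_top ?_
    calc _ ≤ ∫⁻ _, 1 ∂P.priorδ := by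
          refine lintegral_mono fun δ => ?_
          rw [← ENNReal.ofReal_one]
          refine ENNReal.ofReal_le_ofReal (Real.exp_le_one_iff.mpr ?_)
          rw [neg_div, neg_nonpos]
          positivity
      _ = 1 := by simp
  · rw [lintegral_congr_ae (P.ae_priorδ.mono fun δ hδ => P.likelihood_eq y β hδ),
      lintegral_const_mul _ (by fun_prop), P.lintegral_priorδ_exp, profile]
    ring

theorem measurable_coef (k : Fin (K + 1)) : Measurable fun θ : Param K p => coef θ k := by
  refine Fin.cases ?_ (fun k => ?_) k
  · simp only [coef, Fin.cons_zero]; fun_prop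
  · simp only [coef, Fin.cons_succ]
    exact measurable_fst.add ((measurable_pi_apply k).comp measurable_snd)

theorem measurable_likelihood (y : P.Data) : Measurable (P.likelihood y) := by
  unfold likelihood
  refine Finset.measurable_prod _ fun k _ => Finset.measurable_prod _ fun i _ => ?_
  have h1 : Measurable fun θ : Param K p => (P.X k *ᵥ coef θ k) i := by
    unfold Matrix.mulVec dotProduct
    exact Finset.measurable_sum _ fun j _ =>
      ((measurable_pi_apply j).comp (measurable_coef k)).const_mul _
  exact measurable_uncurry_gaussianPDF.comp
    (h1.prodMk (measurable_const.prodMk measurable_const))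

instance : IsFiniteMeasure P.priorβ := by
  unfold priorβ
  have : ∀ S : Finset (Fin p), IsFiniteMeasure
      (ENNReal.ofReal (P.q₀ ^ S.card * (1 - P.q₀) ^ (p - S.card)) •
        slabOn S (P.η ^ 2 * P.σ ^ 2)) := fun S => Measure.smul_finite _ ENNReal.ofReal_ne_top
  refine ⟨?_⟩
  rw [Measure.finsetSum_apply]
  exact ENNReal.sum_lt_top.mpr fun S _ => measure_lt_top _ _

theorem setLIntegral_likelihood {Z : ENNReal} {y : P.Data}
    (hZ : ∀ β, ∫⁻ δ, P.likelihood y (β, δ) ∂P.priorδ = Z * P.profile y β) (hZ' : Z ≠ ⊤)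
    {B : Set (Fin p → ℝ)} (hB : MeasurableSet B) :
    ∫⁻ θ in {θ : Param K p | θ.1 ∈ B}, P.likelihood y θ ∂P.prior =
      Z * ∫⁻ β in B, P.profile y β ∂P.priorβ := by
  have hB' : MeasurableSet {θ : Param K p | θ.1 ∈ B} := measurable_fst hB
  rw [← lintegral_indicator hB', ← lintegral_indicator hB, prior,
    MeasureTheory.lintegral_prod _ ((P.measurable_likelihood y).indicator hB').aemeasurable,
    ← lintegral_const_mul' _ _ hZ']
  refine lintegral_congr fun β => ?_
  by_cases hβ : β ∈ B
  · rw [Set.indicator_of_mem hβ, ← hZ]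
    exact lintegral_congr fun δ => Set.indicator_of_mem (by exact hβ) _
  · rw [Set.indicator_of_notMem hβ, mul_zero, ← lintegral_zero (μ := P.priorδ)]
    exact lintegral_congr fun δ => Set.indicator_of_notMem (by exact hβ) _

/-- The posterior of the target coefficients. -/
theorem posterior_apply (y : P.Data) {B : Set (Fin p → ℝ)} (hB : MeasurableSet B) :
    P.posterior y {θ | θ.1 ∈ B} =
      (∫⁻ β, P.profile y β ∂P.priorβ)⁻¹ * ∫⁻ β in B, P.profile y β ∂P.priorβ := by
  obtain ⟨Z, hZ0, hZ, h⟩ := P.exists_marginal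
  have h1 := P.setLIntegral_likelihood (h y) hZ hB
  have h2 := P.setLIntegral_likelihood (h y) hZ MeasurableSet.univ
  rw [show {θ : Param K p | θ.1 ∈ Set.univ} = Set.univ by ext; simp, Measure.restrict_univ,
    Measure.restrict_univ] at h2
  have hB' : MeasurableSet {θ : Param K p | θ.1 ∈ B} := measurable_fst hB
  rw [posterior, Measure.smul_apply, withDensity_apply _ hB', smul_eq_mul]
  rw [h1, h2, ENNReal.mul_inv (Or.inl hZ0) (Or.inl hZ), mul_mul_mul_comm,
    ENNReal.inv_mul_cancel hZ0 hZ, one_mul]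

theorem posterior_le_one (y : P.Data) (B : Set (Param K p)) : P.posterior y B ≤ 1 := by
  refine (measure_mono (Set.subset_univ B)).trans ?_
  rw [posterior, Measure.smul_apply, withDensity_apply _ MeasurableSet.univ, smul_eq_mul,
    Measure.restrict_univ]
  exact ENNReal.inv_mul_le_one _

end Problem

theorem sqNorm_mulVec_le {ι : Type*} [Fintype ι] {p : ℕ} (X : Matrix ι (Fin p) ℝ) {n : ℝ}
    (hn : 0 ≤ n) (hX : ∀ j, sqNorm (fun i => X i j) ≤ n) (b : Fin p → ℝ) :
    sqNorm (X *ᵥ b) ≤ (∑ j, |b j|) ^ 2 * n := by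
  let x : Fin p → EuclideanSpace ℝ ι := fun j => WithLp.toLp 2 fun i => X i j
  have hx : ∀ j, ‖x j‖ ≤ √n := fun j => by
    refine Real.le_sqrt_of_sq_le ?_
    rw [EuclideanSpace.real_norm_sq_eq]
    exact hX j
  have h := norm_comb_le x b hx
  have e : sqNorm (X *ᵥ b) = ‖comb x b‖ ^ 2 := by
    rw [EuclideanSpace.real_norm_sq_eq, sqNorm]
    refine Finset.sum_congr rfl fun i _ => ?_
    congr 1
    simp [comb, x, Matrix.mulVec, dotProduct, mul_comm]
  rw [e]
  calc ‖comb x b‖ ^ 2 ≤ ((∑ j, |b j|) * √n) ^ 2 := pow_le_pow_left₀ (norm_nonneg _) h 2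
    _ = _ := by rw [mul_pow, Real.sq_sqrt hn]

namespace Problem

variable {K p : ℕ} (P : Problem K p)

/-! ### The design in the geometry of the marginal likelihood -/

/-- The part of a stacked vector that belongs to data set `k`. -/
def slice (u : P.Obs → ℝ) (k : Fin (K + 1)) : Fin (P.n k) → ℝ := fun i => u ⟨k, i⟩

theorem sum_sq_eq (u : P.Obs → ℝ) : ∑ o, u o ^ 2 = ∑ k, sqNorm (P.slice u k) :=
  Fintype.sum_sigma _

theorem slice_fit (b : Fin p → ℝ) (k : Fin (K + 1)) : P.slice (P.fit b) k = P.X k *ᵥ b := rfl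

/-- The covariates in the geometry of the marginal likelihood. -/
def xw (j : Fin p) : P.Aug := P.whiten fun o => P.X o.1 o.2 j

theorem comb_xw (b : Fin p → ℝ) : comb P.xw b = P.whiten (P.fit b) := by
  have : P.fit b = ∑ j, b j • fun o : P.Obs => P.X o.1 o.2 j := by
    ext o; simp [fit, Matrix.mulVec, dotProduct, mul_comm]
  rw [this, map_sum, comb]
  exact Finset.sum_congr rfl fun j _ => (map_smul _ _ _).symm

theorem contrast_zero : P.contrast 0 = 0 := by
  have := P.contrast_smul 0 0
  rwa [zero_smul, zero_smul] at this

theorem sq_norm_whiten_le_sum (u : P.Obs → ℝ) : ‖P.whiten u‖ ^ 2 ≤ ∑ o, u o ^ 2 := by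
  have h := P.sq_norm_whiten_le u 0
  simpa [contrastFit, contrast_zero, mask] using h

theorem Tall_zero : P.Tall 0 = ∅ := rfl

theorem Tall_succ (k : Fin K) : P.Tall k.succ = P.Tstar k := rfl

theorem contrast_eq_zero (δ : Fin K → Fin p → ℝ) (k : Fin (K + 1)) {j : Fin p}
    (hj : j ∉ P.Tall k) : P.contrast δ k j = 0 := by
  induction k using Fin.cases with
  | zero => simp [contrast]
  | succ k => rw [Tall_succ] at hj; simp [contrast, mask, hj]

theorem minEigenvalueGE_of_isEmpty {n : Type*} [DecidableEq n] [IsEmpty n] (A : Matrix n n ℝ)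
    (c : ℝ) : MinEigenvalueGE A c := by
  rw [MinEigenvalueGE, Subsingleton.elim (A - c • 1) 0]
  exact Matrix.PosSemidef.zero

theorem Qk_zero : P.Qk 0 = 1 := by
  have : proj (P.X 0) (P.Tall 0) = 0 := by
    rw [Tall_zero]; ext i j; simp [proj, Matrix.mul_apply]
  rw [Qk, this, sub_zero]

theorem sqNorm_slice_sub (u : P.Obs → ℝ) (δ : Fin K → Fin p → ℝ) (k : Fin (K + 1)) :
    P.slice (fun o => u o - P.contrastFit δ o) k = P.slice u k - P.X k *ᵥ P.contrast δ k := rfl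

variable {P} {lam C₃ d₁ d₂ : ℝ}

theorem Design.nuisance_eigenvalue (hX : P.Design lam C₃ d₁ d₂) (k : Fin (K + 1)) :
    MinEigenvalueGE ((cols (P.X k) (P.Tall k))ᵀ * cols (P.X k) (P.Tall k)) (P.n k * lam) := by
  by_cases h : P.Tall k = ∅
  · have : IsEmpty (P.Tall k) := by rw [h]; infer_instance
    exact minEigenvalueGE_of_isEmpty _ _
  · induction k using Fin.cases with
    | zero => exact absurd P.Tall_zero h
    | succ k =>
      exact hX.source_eigenvalue k (Finset.card_pos.mpr (Finset.nonempty_iff_ne_empty.mpr h))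

theorem n_mul_pos (P : Problem K p) (hlam : 0 < lam) (k : Fin (K + 1)) : 0 < P.n k * lam :=
  mul_pos (by exact_mod_cast P.n_pos k) hlam

/-- At the minimising contrast drop the nonnegative penalty. In each data set `Q̃_k` annihilates the
fitted contrast and does not increase norms. -/
theorem Design.sum_sqNorm_Qk_le (hX : P.Design lam C₃ d₁ d₂) (hlam : 0 < lam) (u : P.Obs → ℝ) :
    ∑ k, sqNorm (P.Qk k *ᵥ P.slice u k) ≤ ‖P.whiten u‖ ^ 2 := by
  obtain ⟨m, -, hm⟩ := P.exists_minimizer u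
  have h0 := hm 0
  rw [zero_add, map_zero, norm_zero, zero_pow two_ne_zero, add_zero, sq_norm_lift_sub] at h0
  rw [← h0, sum_sq_eq (P := P) (fun o => u o - P.contrastFit m o)]
  refine le_add_of_le_of_nonneg (Finset.sum_le_sum fun k _ => ?_) (by positivity)
  have hk := hX.nuisance_eigenvalue k
  rw [sqNorm_slice_sub]
  calc sqNorm (P.Qk k *ᵥ P.slice u k)
      = sqNorm (P.Qk k *ᵥ (P.slice u k - P.X k *ᵥ P.contrast m k)) := by
        rw [Matrix.mulVec_sub, Qk, one_sub_proj_mulVec (P.n_mul_pos hlam k) hk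
          (fun j hj => P.contrast_eq_zero m k hj), sub_zero]
    _ ≤ _ := sqNorm_one_sub_proj_mulVec_le (P.n_mul_pos hlam k) hk _

/-- Test the minimum with the least-squares coefficients of each `u_k` on the columns in `T_k*`: the
residuals are `Q̃_k u_k`, and the eigenvalue bound on those columns controls the penalty. -/
theorem Design.sq_norm_whiten_le (hX : P.Design lam C₃ d₁ d₂) (hlam : 0 < lam) {κ : ℝ}
    (hκ : 0 < κ) (hτ : ∀ k, κ⁻¹ ≤ P.τ k ^ 2) (u : P.Obs → ℝ) :
    ‖P.whiten u‖ ^ 2 ≤ ∑ k, sqNorm (P.Qk k *ᵥ P.slice u k) +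
      ∑ k : Fin K, κ / (P.n k.succ * lam) * sqNorm (P.slice u k.succ) := by
  choose a ha0 hafit hapyth ha using fun k =>
    exists_proj_mulVec (P.n_mul_pos hlam k) (hX.nuisance_eigenvalue k) (P.slice u k)
  have hmask : P.mask (fun k => a k.succ) = fun k => a k.succ :=
    P.mask_eq_self fun k j hj => ha0 k.succ j hj
  have hcon : P.contrast (fun k => a k.succ) = a := by
    ext k j
    induction k using Fin.cases with
    | zero => rw [ha0 0 j (by simp [Tall_zero])]; rfl
    | succ k => simp only [contrast, hmask, Fin.cons_succ]
  refine (P.sq_norm_whiten_le u fun k => a k.succ).trans (add_le_add ?_ ?_)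
  · rw [sum_sq_eq (P := P) (fun o => u o - P.contrastFit _ o)]
    refine (Finset.sum_congr rfl fun k _ => ?_).le
    rw [sqNorm_slice_sub, hcon, hafit, Qk, Matrix.sub_mulVec, Matrix.one_mulVec]
  · rw [hmask]
    refine Finset.sum_le_sum fun k _ => ?_
    have hn := P.n_mul_pos hlam k.succ
    rw [← Finset.sum_div, div_mul_eq_mul_div, div_le_div_iff₀ (pow_pos (P.τ_pos k) 2) hn]
    have h1 := ha k.succ
    have h2 : 1 ≤ κ * P.τ k ^ 2 := by
      have := mul_le_mul_of_nonneg_left (hτ k) hκ.le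
      rwa [mul_inv_cancel₀ hκ.ne'] at this
    have h3 := sqNorm_nonneg (P.slice u k.succ)
    nlinarith [mul_le_mul_of_nonneg_right h2 h3]

theorem Design.norm_xw_le (hX : P.Design lam C₃ d₁ d₂) (j : Fin p) : ‖P.xw j‖ ≤ √P.N := by
  refine Real.le_sqrt_of_sq_le ((P.sq_norm_whiten_le_sum _).trans ?_)
  rw [sum_sq_eq (P := P), N, Nat.cast_sum]
  exact (Finset.sum_congr rfl fun k _ => hX.normalized k j).le

/-- With the lower bound `c₀ N` on the left-hand side, this makes `n_S` comparable to `N` for every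
nonempty model. -/
theorem nj_univ_le_nS {S : Finset (Fin p)} {j : Fin p} (hj : j ∈ S) :
    P.nj Finset.univ j ≤ P.nS S := by
  refine Nat.add_le_add_left (Finset.sum_le_sum_of_subset fun k hk => ?_) _
  refine Finset.mem_biUnion.mpr ⟨j, hj, ?_⟩
  simp only [Hj, Finset.mem_filter, Finset.mem_sdiff, Finset.mem_univ, true_and] at hk ⊢
  exact ⟨hj, hk⟩

theorem nS_le_N (S : Finset (Fin p)) : P.nS S ≤ P.N := by
  rw [N, Fin.sum_univ_succ, nS]
  exact Nat.add_le_add_left (Finset.sum_le_sum_of_subset (Finset.subset_univ _)) _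

theorem nS_pos (S : Finset (Fin p)) : 0 < P.nS S := Nat.add_pos_left (P.n_pos 0) _

theorem N_pos : 0 < P.N := (nS_pos (P := P) ∅).trans_le (nS_le_N ∅)

/-- The restricted eigenvalue condition in the geometry of the marginal likelihood. -/
theorem Design.le_sq_norm_comb (hX : P.Design lam C₃ d₁ d₂) (hlam : 0 < lam) {c₀ C₁ C₂ : ℝ}
    (hT : P.TrueModel c₀ C₁ C₂) {S : Finset (Fin p)} (hS : S.card ≤ P.Ls) {b : Fin p → ℝ}
    (hb : ∀ j, j ∉ S → b j = 0) : c₀ * lam * P.N * ∑ j, b j ^ 2 ≤ ‖comb P.xw b‖ ^ 2 := by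
  rcases S.eq_empty_or_nonempty with rfl | ⟨j, hj⟩
  · have : b = 0 := by ext j; exact hb j (by simp)
    simp [this]
  have hn : (0 : ℝ) < P.nS S := by exact_mod_cast nS_pos S
  have hN : c₀ * P.N ≤ P.nS S := (hT.informative j).trans (by exact_mod_cast nj_univ_le_nS hj)
  have hb2 : 0 ≤ ∑ j, b j ^ 2 := Finset.sum_nonneg fun _ _ => sq_nonneg _
  have h1 := (hX.restricted_eigenvalue S hS).le_dotProduct fun j => b j
  rw [sum_restrict_sq S hb, Matrix.smul_mulVec, dotProduct_smul, smul_eq_mul, inv_mul_eq_div,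
    le_div_iff₀ hn] at h1
  have h2 : (fun j : S => b j) ⬝ᵥ (P.gramH S *ᵥ fun j => b j) =
      ∑ k ∈ insert 0 ((P.H S).image Fin.succ), sqNorm (P.Xt k *ᵥ b) := by
    rw [gramH, Matrix.sum_mulVec, dotProduct_sum]
    refine Finset.sum_congr rfl fun k _ => ?_
    rw [← sqNorm_mulVec_eq, cols_mulVec_restrict _ _ hb]
  rw [h2] at h1
  calc c₀ * lam * P.N * ∑ j, b j ^ 2 = (c₀ * P.N) * (lam * ∑ j, b j ^ 2) := by ring
    _ ≤ P.nS S * (lam * ∑ j, b j ^ 2) := mul_le_mul_of_nonneg_right hN (by positivity)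
    _ = lam * (∑ j, b j ^ 2) * P.nS S := by ring
    _ ≤ _ := h1
    -- The data sets outside `H S` can only add to the sum of squares.
    _ ≤ ∑ k, sqNorm (P.Xt k *ᵥ b) := Finset.sum_le_sum_of_subset_of_nonneg
        (Finset.subset_univ _) fun _ _ _ => sqNorm_nonneg _
    _ = ∑ k, sqNorm (P.Qk k *ᵥ P.slice (P.fit b) k) := by
        simp_rw [slice_fit, Xt, Matrix.mulVec_mulVec]
    _ ≤ _ := by
        rw [comb_xw]
        exact hX.sum_sqNorm_Qk_le hlam _

/-! ### The bias -/

variable (P)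

/-- The large coefficients of the truth. -/
def βlarge (j : Fin p) : ℝ := if j ∈ P.Sstar then P.β j else 0

/-- The means of the observations. -/
def mean (o : P.Obs) : ℝ := (P.X o.1 *ᵥ coef P.θstar o.1) o.2

/-- The part of the mean not explained by the large coefficients. -/
def bias : P.Aug := P.whiten (P.mean - P.fit P.βlarge)

theorem βlarge_eq_zero {j : Fin p} (hj : j ∉ P.Sstar) : P.βlarge j = 0 := if_neg hj

theorem sum_sqNorm_Xt (b : Fin p → ℝ) : ∑ k, sqNorm (P.Xt k *ᵥ b) = sqNorm (P.XT *ᵥ b) :=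
  (Fintype.sum_sigma fun o : P.Obs => (P.XT *ᵥ b) o ^ 2).symm

theorem colsMulVec_compl_eq {ι : Type*} (A : Matrix ι (Fin p) ℝ) :
    colsMulVec A P.Sstarᶜ P.β = A *ᵥ (P.β - P.βlarge) := by
  rw [colsMulVec_eq]
  congr 1
  ext j
  by_cases hj : j ∈ P.Sstar <;> simp [βlarge, hj]

variable {P}

/-- The target alone suffices, as its mean involves no contrast: the fit of `βlarge` is the whole
mean minus the small-signal part, and the eigenvalue bound on `S*` turns fit into coefficients. -/
theorem Design.sum_sq_βlarge_le (hX : P.Design lam C₃ d₁ d₂) (hlam : 0 < lam) {c₀ C₁ C₂ : ℝ}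
    (hT : P.TrueModel c₀ C₁ C₂) (hC₂ : 0 ≤ C₂) :
    ∑ j, P.βlarge j ^ 2 ≤ (2 * C₁ + C₂) / lam * P.σ ^ 2 * Real.log p := by
  have hn := P.n_mul_pos hlam 0
  have hn1 : (1 : ℝ) ≤ P.n 0 := by exact_mod_cast P.n_pos 0
  have h1 := hX.target_eigenvalue.le_sqNorm (fun j hj => P.βlarge_eq_zero hj)
  have h2 : sqNorm (P.X 0 *ᵥ P.β) ≤ C₁ * P.n 0 * P.σ ^ 2 * Real.log p := hT.signal 0
  have h3 : sqNorm (P.X 0 *ᵥ (P.β - P.βlarge)) ≤ C₂ / 2 * P.σ ^ 2 * Real.log p := by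
    refine le_trans ?_ hT.small_signal
    rw [colsMulVec_compl_eq, ← sum_sqNorm_Xt]
    -- Since `Q̃_0 = 1`, the untransformed target block is one term of the assumed total.
    refine le_trans (le_of_eq ?_) (Finset.single_le_sum (f := fun k =>
      sqNorm (P.Xt k *ᵥ (P.β - P.βlarge))) (fun _ _ => sqNorm_nonneg _) (Finset.mem_univ 0))
    simp only [Xt, Qk_zero, Matrix.one_mul]
  have h4 : P.X 0 *ᵥ P.βlarge = P.X 0 *ᵥ P.β - P.X 0 *ᵥ (P.β - P.βlarge) := by
    rw [Matrix.mulVec_sub]; abel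
  have h5 := sqNorm_sub_le (P.X 0 *ᵥ P.β) (P.X 0 *ᵥ (P.β - P.βlarge))
  rw [← h4] at h5
  have h6 : C₂ * P.σ ^ 2 * Real.log p ≤ P.n 0 * (C₂ * P.σ ^ 2 * Real.log p) :=
    le_mul_of_one_le_left (by positivity) hn1
  have h7 : P.n 0 * (lam * ∑ j, P.βlarge j ^ 2) ≤
      P.n 0 * ((2 * C₁ + C₂) * P.σ ^ 2 * Real.log p) := by
    nlinarith
  have h8 := le_of_mul_le_mul_left h7 (by linarith)
  rw [div_mul_eq_mul_div, div_mul_eq_mul_div, le_div_iff₀ hlam]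
  linarith

/-- The `Q̃_k` part sees only small signals and small contrasts, since `Q̃_k` kills the contrast on
`T_k*`; this gives `2 C₂`. In the penalty part the slices have squared norm `O(n_k σ² s* log p)`,
and `n_k` cancels. -/
theorem Design.sq_norm_bias_le (hX : P.Design lam C₃ d₁ d₂) (hlam : 0 < lam) {c₀ C₁ C₂ κ : ℝ}
    (hT : P.TrueModel c₀ C₁ C₂) (hC₁ : 0 ≤ C₁) (hC₂ : 0 ≤ C₂) (hκ : 0 < κ)
    (hτ : ∀ k, κ⁻¹ ≤ P.τ k ^ 2) (hs : 1 ≤ P.Sstar.card) :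
    ‖P.bias‖ ^ 2 ≤ (2 * C₂ + K * (κ / lam * (2 * C₁ + 2 * ((2 * C₁ + C₂) / lam)))) * P.σ ^ 2 *
      (P.Sstar.card * Real.log p) := by
  have hs' : (1 : ℝ) ≤ P.Sstar.card := by exact_mod_cast hs
  set L := P.σ ^ 2 * Real.log p with hL
  have hL0 : 0 ≤ L := by positivity
  set Cb := (2 * C₁ + C₂) / lam with hCb
  have hCb0 : 0 ≤ Cb := by positivity
  have hslice : ∀ k, P.slice (P.mean - P.fit P.βlarge) k =
      P.X k *ᵥ coef P.θstar k - P.X k *ᵥ P.βlarge := fun k => rfl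
  have hQ : ∑ k, sqNorm (P.Qk k *ᵥ P.slice (P.mean - P.fit P.βlarge) k) ≤ 2 * C₂ * L := by
    have h1 : ∑ k, sqNorm (P.Xt k *ᵥ (P.β - P.βlarge)) ≤ C₂ / 2 * L := by
      rw [sum_sqNorm_Xt, ← colsMulVec_compl_eq, hL, ← mul_assoc]
      exact hT.small_signal
    have h2 : ∑ k : Fin K, sqNorm (colsMulVec (P.Xt k.succ) (P.Tstar k)ᶜ (P.δ k)) ≤ C₂ / 2 * L := by
      rw [hL, ← mul_assoc]; exact hT.small_contrast
    rw [Fin.sum_univ_succ] at h1 ⊢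
    have h3 : sqNorm (P.Qk 0 *ᵥ P.slice (P.mean - P.fit P.βlarge) 0) =
        sqNorm (P.Xt 0 *ᵥ (P.β - P.βlarge)) := by
      rw [hslice, ← Matrix.mulVec_sub, Matrix.mulVec_mulVec]; rfl
    have h4 : ∀ k : Fin K, sqNorm (P.Qk k.succ *ᵥ P.slice (P.mean - P.fit P.βlarge) k.succ) ≤
        2 * sqNorm (P.Xt k.succ *ᵥ (P.β - P.βlarge)) +
          2 * sqNorm (colsMulVec (P.Xt k.succ) (P.Tstar k)ᶜ (P.δ k)) := by
      intro k
      have e1 : P.δ k = (fun j => if j ∈ P.Tstar k then P.δ k j else 0) +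
          fun j => if j ∈ (P.Tstar k)ᶜ then P.δ k j else 0 := by
        ext j; by_cases hj : j ∈ P.Tstar k <;> simp [hj]
      have e2 : P.Qk k.succ *ᵥ (P.X k.succ *ᵥ fun j => if j ∈ P.Tstar k then P.δ k j else 0) = 0 :=
        one_sub_proj_mulVec (P.n_mul_pos hlam k.succ) (hX.nuisance_eigenvalue k.succ)
          fun j hj => if_neg hj
      have e3 : P.Qk k.succ *ᵥ P.slice (P.mean - P.fit P.βlarge) k.succ =
          P.Xt k.succ *ᵥ (P.β - P.βlarge) + colsMulVec (P.Xt k.succ) (P.Tstar k)ᶜ (P.δ k) := by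
        have e4 : coef P.θstar k.succ = P.β + P.δ k := by simp [coef, θstar]
        rw [hslice, e4, colsMulVec_eq, Xt, ← Matrix.mulVec_mulVec, ← Matrix.mulVec_mulVec,
          ← Matrix.mulVec_sub, ← Matrix.mulVec_add, ← Matrix.mulVec_add, add_sub_right_comm]
        conv_lhs => rw [e1]
        rw [Matrix.mulVec_add (P.X k.succ), Matrix.mulVec_add (P.X k.succ), Matrix.mulVec_add,
          Matrix.mulVec_add, Matrix.mulVec_add, Matrix.mulVec_add, e2, zero_add]
      rw [e3]
      exact sqNorm_add_le _ _
    have h5 := Finset.sum_le_sum fun k (_ : k ∈ Finset.univ) => h4 k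
    rw [Finset.sum_add_distrib, ← Finset.mul_sum, ← Finset.mul_sum] at h5
    have h6 := sqNorm_nonneg (P.Xt 0 *ᵥ (P.β - P.βlarge))
    rw [h3]
    linarith
  have hb := hX.sum_sq_βlarge_le hlam hT hC₂
  have hb1 : (∑ j, |P.βlarge j|) ^ 2 ≤ P.Sstar.card * (Cb * L) := by
    refine (sq_sum_abs_le fun j hj => P.βlarge_eq_zero hj).trans ?_
    refine mul_le_mul_of_nonneg_left ?_ (by positivity)
    rw [hL, ← mul_assoc]; exact hb
  have hk : ∀ k : Fin K, κ / (P.n k.succ * lam) *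
      sqNorm (P.slice (P.mean - P.fit P.βlarge) k.succ) ≤
      κ / lam * (2 * C₁ + 2 * Cb) * (P.Sstar.card * L) := by
    intro k
    have hn : (0 : ℝ) < P.n k.succ := by exact_mod_cast P.n_pos k.succ
    have h1 := hT.signal k.succ
    have h2 := sqNorm_mulVec_le (P.X k.succ) hn.le (fun j => (hX.normalized k.succ j).le) P.βlarge
    have h3 := sqNorm_sub_le (P.X k.succ *ᵥ coef P.θstar k.succ) (P.X k.succ *ᵥ P.βlarge)
    rw [← hslice] at h3
    have h4 : sqNorm (P.slice (P.mean - P.fit P.βlarge) k.succ) ≤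
        P.n k.succ * ((2 * C₁ + 2 * Cb) * (P.Sstar.card * L)) := by
      have h5 := mul_le_mul_of_nonneg_right hb1 hn.le
      have h6 : C₁ * L * P.n k.succ ≤ C₁ * L * P.n k.succ * P.Sstar.card :=
        le_mul_of_one_le_right (by positivity) hs'
      have h7 : C₁ * P.n k.succ * P.σ ^ 2 * Real.log p = C₁ * L * P.n k.succ := by rw [hL]; ring
      rw [h7] at h1
      nlinarith
    calc _ ≤ κ / (P.n k.succ * lam) * (P.n k.succ * ((2 * C₁ + 2 * Cb) * (P.Sstar.card * L))) :=
          mul_le_mul_of_nonneg_left h4 (by positivity)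
      _ = _ := by field_simp
  have hw := hX.sq_norm_whiten_le hlam hκ hτ (P.mean - P.fit P.βlarge)
  have hsum := Finset.sum_le_sum fun k (_ : k ∈ Finset.univ) => hk k
  rw [Finset.sum_const, Finset.card_univ, Fintype.card_fin, nsmul_eq_mul] at hsum
  have h8 : 2 * C₂ * L ≤ 2 * C₂ * L * P.Sstar.card := le_mul_of_one_le_right (by positivity) hs'
  rw [bias]
  calc _ ≤ 2 * C₂ * L * P.Sstar.card +
        K * (κ / lam * (2 * C₁ + 2 * Cb) * (P.Sstar.card * L)) := by linarith
    _ = _ := by rw [hL]; ring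

end Problem

namespace Problem

variable {K p : ℕ} (P : Problem K p)

/-! ### The noise -/

/-- The noise in the observations. -/
def noise (y : P.Data) (o : P.Obs) : ℝ := y o.1 o.2 - P.mean o

theorem resid_eq (y : P.Data) (β : Fin p → ℝ) :
    P.whiten (P.resid y β) = P.whiten (P.noise y) + P.bias - comb P.xw (β - P.βlarge) := by
  rw [comb_sub, comb_xw, comb_xw, bias, map_sub, ← add_sub_assoc, sub_sub_sub_cancel_right,
    ← map_add, ← map_sub]
  congr 1
  ext o
  simp [resid, noise]

instance : IsProbabilityMeasure (P.dataLaw P.θstar) := by unfold dataLaw; infer_instance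

theorem measurable_noise (o : P.Obs) : Measurable fun y => P.noise y o := by
  unfold noise
  exact ((measurable_pi_apply o.2).comp (measurable_pi_apply o.1)).sub_const _

theorem lintegral_exp_noise (a : P.Obs → ℝ) :
    ∫⁻ y, ENNReal.ofReal (Real.exp (∑ o, a o * P.noise y o)) ∂P.dataLaw P.θstar =
      ENNReal.ofReal (Real.exp (P.σ ^ 2 * (∑ o, a o ^ 2) / 2)) := by
  have hσ : 0 < P.σ ^ 2 := pow_pos P.σ_pos 2
  have e : ∀ y : P.Data, ENNReal.ofReal (Real.exp (∑ o, a o * P.noise y o)) =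
      ∏ k, ∏ i, ENNReal.ofReal (Real.exp (a ⟨k, i⟩ * (y k i - P.mean ⟨k, i⟩))) := by
    intro y
    rw [Real.exp_sum, ENNReal.ofReal_prod_of_nonneg (fun _ _ => (Real.exp_pos _).le)]
    exact Fintype.prod_sigma _
  simp_rw [e]
  unfold dataLaw
  rw [lintegral_pi_prod_eq_prod (fun k (x : Fin (P.n k) → ℝ) =>
    ∏ i, ENNReal.ofReal (Real.exp (a ⟨k, i⟩ * (x i - P.mean ⟨k, i⟩)))) (fun k => by fun_prop)]
  have e2 : ∀ k, ∫⁻ x : Fin (P.n k) → ℝ,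
      ∏ i, ENNReal.ofReal (Real.exp (a ⟨k, i⟩ * (x i - P.mean ⟨k, i⟩)))
      ∂(Measure.pi fun i => gaussianReal ((P.X k *ᵥ coef P.θstar k) i) (P.σ ^ 2).toNNReal) =
      ∏ i, ENNReal.ofReal (Real.exp (a ⟨k, i⟩ ^ 2 * P.σ ^ 2 / 2)) := by
    intro k
    rw [lintegral_pi_prod_eq_prod (fun i (t : ℝ) =>
      ENNReal.ofReal (Real.exp (a ⟨k, i⟩ * (t - P.mean ⟨k, i⟩)))) (fun i => by fun_prop)]
    exact Finset.prod_congr rfl fun i _ =>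
      lintegral_exp_mul_sub_gaussianReal hσ (P.mean ⟨k, i⟩) (a ⟨k, i⟩)
  simp_rw [e2]
  rw [← Fintype.prod_sigma (fun o : P.Obs => ENNReal.ofReal (Real.exp (a o ^ 2 * P.σ ^ 2 / 2))),
    ← ENNReal.ofReal_prod_of_nonneg (fun _ _ => (Real.exp_pos _).le), ← Real.exp_sum,
    ← Finset.sum_div, ← Finset.sum_mul, mul_comm (P.σ ^ 2)]

/-- The projection is self-adjoint, so it can be moved onto `r`; the pseudo-coordinates of the
lifted vector vanish. -/
theorem exists_inner_whiten (r : P.Aug) : ∃ a : P.Obs → ℝ, ∑ o, a o ^ 2 ≤ ‖r‖ ^ 2 ∧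
    ∀ u, inner ℝ (P.whiten u) r = ∑ o, a o * u o := by
  set r' := (LinearMap.range P.contrastMap)ᗮ.starProjection r with hr'
  refine ⟨fun o => r' (Sum.inl o), ?_, fun u => ?_⟩
  · calc ∑ o, r' (Sum.inl o) ^ 2 ≤ ‖r'‖ ^ 2 := by
          rw [EuclideanSpace.real_norm_sq_eq, Fintype.sum_sum_type]
          exact le_add_of_nonneg_right (Finset.sum_nonneg fun _ _ => sq_nonneg _)
      _ ≤ ‖r‖ ^ 2 := pow_le_pow_left₀ (norm_nonneg _) (Submodule.norm_starProjection_apply_le _ _) 2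
  · have h : inner ℝ (P.whiten u) r = inner ℝ (P.lift u) r' :=
      Submodule.inner_starProjection_left_eq_right _ _ _
    rw [h, EuclideanSpace.inner_eq_star_dotProduct, dotProduct, Fintype.sum_sum_type]
    simp [lift]

/-- Tail bound of a linear functional of the noise. -/
theorem dataLaw_lt_inner_le (r : P.Aug) {t : ℝ} (ht : 0 ≤ t) :
    P.dataLaw P.θstar {y | ‖r‖ * (P.σ * √(2 * t)) < inner ℝ (P.whiten (P.noise y)) r} ≤
      ENNReal.ofReal (Real.exp (-t)) := by
  obtain ⟨a, ha, hinner⟩ := P.exists_inner_whiten r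
  have hσ := P.σ_pos
  rcases (norm_nonneg r).eq_or_lt with h0 | hr
  · have : r = 0 := norm_eq_zero.mp h0.symm
    simp [this]
  -- The optimal Chernoff parameter: the threshold becomes `exp(2t)` and the moment generating
  -- function at most `exp t`.
  set s : ℝ := √(2 * t) / (P.σ * ‖r‖) with hs
  have hs0 : 0 ≤ s := by positivity
  have hst : s * (‖r‖ * (P.σ * √(2 * t))) = 2 * t := by
    rw [hs]; field_simp; exact Real.sq_sqrt (by positivity)
  have hs2 : s ^ 2 * (P.σ ^ 2 * ‖r‖ ^ 2) = 2 * t := by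
    rw [hs]; field_simp; exact Real.sq_sqrt (by positivity)
  have hmeas := P.measurable_noise
  calc _ ≤ P.dataLaw P.θstar {y | ENNReal.ofReal (Real.exp (2 * t)) ≤
        ENNReal.ofReal (Real.exp (∑ o, s * a o * P.noise y o))} := by
        refine measure_mono fun y hy => ENNReal.ofReal_le_ofReal (Real.exp_le_exp.mpr ?_)
        simp only [Set.mem_ofPred_eq, hinner] at hy
        simp_rw [mul_assoc]
        rw [← Finset.mul_sum, ← hst]
        exact mul_le_mul_of_nonneg_left hy.le hs0
    _ ≤ (∫⁻ y, ENNReal.ofReal (Real.exp (∑ o, s * a o * P.noise y o)) ∂P.dataLaw P.θstar) /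
        ENNReal.ofReal (Real.exp (2 * t)) :=
      meas_ge_le_lintegral_div (by fun_prop)
        (by rw [Ne, ENNReal.ofReal_eq_zero, not_le]; exact Real.exp_pos _) ENNReal.ofReal_ne_top
    _ ≤ _ := by
        rw [lintegral_exp_noise, ← ENNReal.ofReal_div_of_pos (Real.exp_pos _), ← Real.exp_sub]
        refine ENNReal.ofReal_le_ofReal (Real.exp_le_exp.mpr ?_)
        simp_rw [mul_pow]
        rw [← Finset.mul_sum]
        have : s ^ 2 * (P.σ ^ 2 * ∑ o, a o ^ 2) ≤ s ^ 2 * (P.σ ^ 2 * ‖r‖ ^ 2) := by gcongr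
        linarith

/-- The event on which the noise is not too correlated with the covariates and with the residuals
of the regressions of the large signals on the sparse models. -/
structure NoiseBound (y : P.Data) : Prop where
  covariate : ∀ j, |inner ℝ (P.whiten (P.noise y)) (P.xw j)| ≤
    √P.N * (P.σ * √(2 * (2 * Real.log p)))
  residual : ∀ S : Finset (Fin p), inner ℝ (P.whiten (P.noise y))
    (-residual P.xw S (comb P.xw P.βlarge)) ≤ ‖residual P.xw S (comb P.xw P.βlarge)‖ *
      (P.σ * √(2 * ((S.card + 1) * Real.log p)))

variable {P}

theorem one_add_inv_pow_le (hp : 0 < p) : (1 + (p : ℝ)⁻¹) ^ p ≤ 3 := by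
  have hp' : (0 : ℝ) < p := by exact_mod_cast hp
  calc (1 + (p : ℝ)⁻¹) ^ p ≤ Real.exp ((p : ℝ)⁻¹) ^ p := by
        refine pow_le_pow_left₀ (by positivity) ?_ p
        rw [add_comm]; exact Real.add_one_le_exp _
    _ = Real.exp 1 := by rw [← Real.exp_nat_mul, mul_inv_cancel₀ hp'.ne']
    _ ≤ 3 := by linarith [Real.exp_one_lt_d9]

/-- The binomial sum is `(1 + 1/p)^p ≤ e`. It pays for all models at once, both in the union bound
for the noise and in the numerator. -/
theorem sum_inv_pow_card_le (hp : 0 < p) :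
    ∑ S : Finset (Fin p), ((p : ℝ)⁻¹) ^ S.card ≤ 3 := by
  have := Fintype.sum_pow_mul_eq_add_pow (Fin p) ((p : ℝ)⁻¹) 1
  simp only [one_pow, mul_one, Fintype.card_fin] at this
  rw [this, add_comm]
  exact one_add_inv_pow_le hp

theorem exp_neg_nat_mul_log (hp : 0 < p) (m : ℕ) :
    Real.exp (-(m * Real.log p)) = ((p : ℝ)⁻¹) ^ m := by
  have hp' : (0 : ℝ) < p := by exact_mod_cast hp
  rw [Real.exp_neg, Real.exp_nat_mul, Real.exp_log hp', inv_pow]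

/-- Union bound. The covariates with both signs cost `2p · p⁻²`; the level `|S| + 1` makes the
residuals of all models cost `∑ p^{-|S|-1} ≤ 3/p`. -/
theorem Design.dataLaw_noiseBound (hX : P.Design lam C₃ d₁ d₂) (hp : 0 < p) :
    ENNReal.ofReal (1 - 5 * (p : ℝ)⁻¹) ≤ P.dataLaw P.θstar {y | P.NoiseBound y} := by
  have hp' : (0 : ℝ) < p := by exact_mod_cast hp
  have hlog : 0 ≤ Real.log p := Real.log_natCast_nonneg p
  set μ := P.dataLaw P.θstar with hμ
  set w := comb P.xw P.βlarge with hw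
  let A : P.Aug → Set P.Data := fun r =>
    {y | ‖r‖ * (P.σ * √(2 * (2 * Real.log p))) < inner ℝ (P.whiten (P.noise y)) r}
  let B : Finset (Fin p) → Set P.Data := fun S =>
    {y | ‖-residual P.xw S w‖ * (P.σ * √(2 * ((S.card + 1) * Real.log p))) <
      inner ℝ (P.whiten (P.noise y)) (-residual P.xw S w)}
  have hcover : {y | P.NoiseBound y}ᶜ ⊆
      (⋃ j, A (P.xw j) ∪ A (-P.xw j)) ∪ ⋃ S, B S := by
    intro y hy
    by_contra hcon
    simp only [Set.mem_union, Set.mem_iUnion, not_or, not_exists, A, B, Set.mem_ofPred_eq,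
      not_lt, norm_neg] at hcon
    refine hy ⟨fun j => ?_, fun S => hcon.2 S⟩
    obtain ⟨h1, h2⟩ := hcon.1 j
    have h3 : ‖P.xw j‖ * (P.σ * √(2 * (2 * Real.log p))) ≤ √P.N * (P.σ * √(2 * (2 * Real.log p))) :=
      mul_le_mul_of_nonneg_right (hX.norm_xw_le j) (mul_nonneg P.σ_pos.le (Real.sqrt_nonneg _))
    rw [inner_neg_right] at h2
    exact abs_le.mpr ⟨by linarith, by linarith⟩
  have hA : ∀ r, μ (A r) ≤ ENNReal.ofReal (((p : ℝ)⁻¹) ^ 2) := fun r => by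
    rw [← exp_neg_nat_mul_log hp]
    exact_mod_cast P.dataLaw_lt_inner_le r (by positivity)
  have hB : ∀ S, μ (B S) ≤ ENNReal.ofReal (((p : ℝ)⁻¹) ^ (S.card + 1)) := fun S => by
    rw [← exp_neg_nat_mul_log hp]
    push_cast
    exact P.dataLaw_lt_inner_le _ (by positivity)
  have hbad : μ {y | P.NoiseBound y}ᶜ ≤ ENNReal.ofReal (5 * (p : ℝ)⁻¹) := by
    calc μ {y | P.NoiseBound y}ᶜ
        ≤ ∑ j, (μ (A (P.xw j)) + μ (A (-P.xw j))) + ∑ S, μ (B S) := by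
          refine (measure_mono hcover).trans ((measure_union_le _ _).trans (add_le_add ?_ ?_))
          · refine (measure_iUnion_le _).trans ?_
            rw [tsum_fintype]
            exact Finset.sum_le_sum fun j _ => measure_union_le _ _
          · refine (measure_iUnion_le _).trans ?_
            rw [tsum_fintype]
      _ ≤ ∑ _j : Fin p, (ENNReal.ofReal (((p : ℝ)⁻¹) ^ 2) + ENNReal.ofReal (((p : ℝ)⁻¹) ^ 2)) +
          ∑ S : Finset (Fin p), ENNReal.ofReal (((p : ℝ)⁻¹) ^ (S.card + 1)) :=
          add_le_add (Finset.sum_le_sum fun j _ => add_le_add (hA _) (hA _))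
            (Finset.sum_le_sum fun S _ => hB S)
      _ = ENNReal.ofReal (2 * (p : ℝ)⁻¹ +
          (p : ℝ)⁻¹ * ∑ S : Finset (Fin p), ((p : ℝ)⁻¹) ^ S.card) := by
          rw [Finset.sum_const, Finset.card_univ, Fintype.card_fin,
            ← ENNReal.ofReal_add (by positivity) (by positivity),
            ← ENNReal.ofReal_sum_of_nonneg (fun _ _ => by positivity), ← ENNReal.ofReal_nsmul,
            ← ENNReal.ofReal_add (by positivity) (by positivity), Finset.mul_sum]
          congr 2
          · rw [nsmul_eq_mul]; field_simp; ring
          · exact Finset.sum_congr rfl fun S _ => by rw [pow_succ, mul_comm]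
      _ ≤ _ := by
          refine ENNReal.ofReal_le_ofReal ?_
          have := mul_le_mul_of_nonneg_left (sum_inv_pow_card_le hp) (inv_nonneg.mpr hp'.le)
          linarith
  rw [ENNReal.ofReal_sub _ (by positivity), ENNReal.ofReal_one, tsub_le_iff_right]
  calc (1 : ENNReal) = μ Set.univ := measure_univ.symm
    _ ≤ μ ({y | P.NoiseBound y} ∪ {y | P.NoiseBound y}ᶜ) := by rw [Set.union_compl_self]
    _ ≤ _ := (measure_union_le _ _).trans (add_le_add le_rfl hbad)

end Problem

namespace Problem

variable {K p : ℕ} (P : Problem K p)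

/-! ### Likelihood ratios -/

/-- Twice the logarithm of the ratio of the marginal likelihoods at `β` and at the large
coefficients of the truth, times the noise variance. -/
def logRatio (y : P.Data) (β : Fin p → ℝ) : ℝ :=
  2 * inner ℝ (P.whiten (P.noise y) + P.bias) (comb P.xw (β - P.βlarge)) -
    ‖comb P.xw (β - P.βlarge)‖ ^ 2

/-- The ratio of the marginal likelihoods at `β` and at the large coefficients of the truth. -/
def ratio (y : P.Data) (β : Fin p → ℝ) : ENNReal :=
  ENNReal.ofReal (Real.exp (P.logRatio y β / (2 * P.σ ^ 2)))

theorem profile_eq (y : P.Data) (β : Fin p → ℝ) :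
    P.profile y β = ENNReal.ofReal
      (Real.exp (-‖P.whiten (P.noise y) + P.bias‖ ^ 2 / (2 * P.σ ^ 2))) * P.ratio y β := by
  rw [profile, ratio, ← ENNReal.ofReal_mul (Real.exp_pos _).le, ← Real.exp_add, ← add_div,
    resid_eq, norm_sub_sq_real, logRatio]
  congr 3
  ring

theorem posterior_eq_ratio (y : P.Data) {B : Set (Fin p → ℝ)} (hB : MeasurableSet B) :
    P.posterior y {θ | θ.1 ∈ B} =
      (∫⁻ β, P.ratio y β ∂P.priorβ)⁻¹ * ∫⁻ β in B, P.ratio y β ∂P.priorβ := by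
  set Z := ENNReal.ofReal
      (Real.exp (-‖P.whiten (P.noise y) + P.bias‖ ^ 2 / (2 * P.σ ^ 2))) with hZ
  have hZ0 : Z ≠ 0 := by rw [hZ, Ne, ENNReal.ofReal_eq_zero, not_le]; exact Real.exp_pos _
  have hZt : Z ≠ ⊤ := ENNReal.ofReal_ne_top
  rw [P.posterior_apply y hB]
  simp_rw [P.profile_eq y]
  rw [lintegral_const_mul' _ _ hZt, lintegral_const_mul' _ _ hZt,
    ENNReal.mul_inv (Or.inl hZ0) (Or.inl hZt), mul_mul_mul_comm, ENNReal.inv_mul_cancel hZ0 hZt,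
    one_mul]

variable {P}

theorem le_nS_of_mem {c₀ C₁ C₂ : ℝ} (hT : P.TrueModel c₀ C₁ C₂) (hs : 1 ≤ P.Sstar.card) :
    c₀ * P.N ≤ P.nS P.Sstar := by
  obtain ⟨j, hj⟩ := Finset.card_pos.mp hs
  exact (hT.informative j).trans (by exact_mod_cast nj_univ_le_nS hj)

/-! ### The numerator of the posterior -/

/-- The surviving negative square is split in two halves: one records the distance of the fits, the
other becomes, by the restricted eigenvalue, a Gaussian in the coefficients of `S`. The bound `c₀ >
1/2` removes `c₀` from the noise constant. -/
theorem Design.logRatio_le (hX : P.Design lam C₃ d₁ d₂) (hlam : 0 < lam) {c₀ C₁ C₂ Cv : ℝ}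
    (hc₀ : 1 / 2 < c₀) (hT : P.TrueModel c₀ C₁ C₂)
    (hv : ‖P.bias‖ ^ 2 ≤ Cv * P.σ ^ 2 * (P.Sstar.card * Real.log p)) {y : P.Data}
    (hy : P.NoiseBound y) {S : Finset (Fin p)} (hS : S.card ≤ P.Ls) :
    ∃ c : Fin p → ℝ, ∀ β : Fin p → ℝ, (∀ j, j ∉ S → β j = 0) →
      P.logRatio y β / (2 * P.σ ^ 2) ≤
        ((16 / (3 * lam) + 4 / 3) * S.card + 4 / 3 + 4 * Cv * P.Sstar.card) * Real.log p -
        ‖comb P.xw (β - P.βlarge)‖ ^ 2 / (32 * P.σ ^ 2) -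
        c₀ * lam * P.N / (32 * P.σ ^ 2) * ∑ j ∈ S, (β j - c j) ^ 2 := by
  have hN : (0 : ℝ) < P.N := by exact_mod_cast N_pos
  have hσ := P.σ_pos
  have hlog : 0 ≤ Real.log p := Real.log_natCast_nonneg p
  have hc : 0 < c₀ := by linarith
  have hLam : 0 < c₀ * lam * P.N := by positivity
  obtain ⟨c, hcβ⟩ := log_ratio_le P.xw P.βlarge (P.whiten (P.noise y)) P.bias S hLam
    (fun b hb => hX.le_sq_norm_comb hlam hT hS hb) hy.covariate (hy.residual S)
  refine ⟨c, fun β hβ => ?_⟩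
  obtain ⟨h1, h2⟩ := hcβ β hβ
  set x := ‖comb P.xw (β - P.βlarge)‖ ^ 2 with hx
  have e1 : (√P.N * (P.σ * √(2 * (2 * Real.log p)))) ^ 2 * S.card / (c₀ * lam * P.N) ≤
      8 / lam * P.σ ^ 2 * S.card * Real.log p := by
    rw [mul_pow, mul_pow, Real.sq_sqrt hN.le, Real.sq_sqrt (by positivity), div_le_iff₀ hLam]
    have h3 : 0 ≤ P.N * P.σ ^ 2 * Real.log p * S.card := by positivity
    have h4 : 8 / lam * P.σ ^ 2 * S.card * Real.log p * (c₀ * lam * P.N) =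
        8 * c₀ * (P.N * P.σ ^ 2 * Real.log p * S.card) := by field_simp
    rw [h4]
    nlinarith
  have e2 : (P.σ * √(2 * ((S.card + 1) * Real.log p))) ^ 2 =
      2 * P.σ ^ 2 * (S.card + 1) * Real.log p := by
    rw [mul_pow, Real.sq_sqrt (by positivity)]; ring
  rw [e2] at h1
  have e3 : P.logRatio y β ≤ 4 / 3 * (8 / lam * P.σ ^ 2 * S.card * Real.log p +
      2 * P.σ ^ 2 * (S.card + 1) * Real.log p) +
      8 * (Cv * P.σ ^ 2 * (P.Sstar.card * Real.log p)) - x / 8 := by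
    rw [logRatio]; linarith
  rw [div_le_iff₀ (by positivity)]
  refine e3.trans ?_
  have e4 : (((16 / (3 * lam) + 4 / 3) * S.card + 4 / 3 + 4 * Cv * P.Sstar.card) * Real.log p -
        x / (32 * P.σ ^ 2) -
        c₀ * lam * P.N / (32 * P.σ ^ 2) * ∑ j ∈ S, (β j - c j) ^ 2) * (2 * P.σ ^ 2) =
      4 / 3 * (8 / lam * P.σ ^ 2 * S.card * Real.log p +
      2 * P.σ ^ 2 * (S.card + 1) * Real.log p) +
      8 * (Cv * P.σ ^ 2 * (P.Sstar.card * Real.log p)) - x / 16 -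
      (c₀ * lam * P.N * ∑ j ∈ S, (β j - c j) ^ 2) / 16 := by
    field_simp
    ring
  rw [e4]
  linarith

/-- Since `N ≥ n_{S*}`, the slab satisfies `N η² ≥ κ⁻¹ p^{2r}`: a wide slab charges about `p^{-r}`
for each covariate. -/
theorem Prior.sqrt_inv_le {κ r c₀ : ℝ} (hPr : P.Prior κ r) (hκ : 0 < κ) (hc₀ : 0 < c₀)
    (hlam : 0 < lam) (hp : 0 < p) :
    (√(2 * (c₀ * lam * P.N / (32 * P.σ ^ 2)) * (P.η ^ 2 * P.σ ^ 2)))⁻¹ ≤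
      √(16 * κ / (c₀ * lam)) * Real.exp (-(r * Real.log p)) := by
  have hσ := P.σ_pos
  have hη := P.η_pos
  have hp' : (0 : ℝ) < p := by exact_mod_cast hp
  have hN : (0 : ℝ) < P.N := by exact_mod_cast N_pos
  have h1 : κ⁻¹ * (p : ℝ) ^ (2 * r) ≤ P.N * P.η ^ 2 := by
    refine le_trans (mul_le_mul_of_nonneg_left (le_max_right _ _) (by positivity))
      (hPr.slab.1.trans ?_)
    gcongr
    exact nS_le_N _
  have h2 : (p : ℝ) ^ (2 * r) = Real.exp (r * Real.log p) ^ 2 := by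
    rw [Real.rpow_def_of_pos hp', ← Real.exp_nat_mul]; congr 1; push_cast; ring
  have h3 : 2 * (c₀ * lam * P.N / (32 * P.σ ^ 2)) * (P.η ^ 2 * P.σ ^ 2) =
      c₀ * lam / 16 * (P.N * P.η ^ 2) := by field_simp; ring
  rw [h3, ← Real.sqrt_inv, Real.exp_neg]
  refine Real.sqrt_le_iff.mpr ⟨by positivity, ?_⟩
  rw [mul_pow, Real.sq_sqrt (by positivity), inv_pow, ← h2]
  calc (c₀ * lam / 16 * (P.N * P.η ^ 2))⁻¹ ≤ (c₀ * lam / 16 * (κ⁻¹ * (p : ℝ) ^ (2 * r)))⁻¹ := by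
        gcongr
    _ = _ := by
        have : (0 : ℝ) < (p : ℝ) ^ (2 * r) := Real.rpow_pos_of_pos hp' _
        field_simp

/-- The contribution of one sparse model to the numerator of the posterior. -/
theorem Design.weight_mul_setLIntegral_le (hX : P.Design lam C₃ d₁ d₂) (hlam : 0 < lam)
    {c₀ C₁ C₂ Cv κ r : ℝ} (hc₀ : 1 / 2 < c₀) (hT : P.TrueModel c₀ C₁ C₂)
    (hPr : P.Prior κ r) (hκ : 0 < κ) (hlam1 : lam < 1) (hr : 1 + 8 * lam⁻¹ ≤ r)
    (hv : ‖P.bias‖ ^ 2 ≤ Cv * P.σ ^ 2 * (P.Sstar.card * Real.log p)) (hs : 1 ≤ P.Sstar.card)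
    (hp : 0 < p) (hpκ : κ * √(16 * κ / (c₀ * lam)) ≤ p) {y : P.Data} (hy : P.NoiseBound y)
    {S : Finset (Fin p)} (hS : S.card ≤ P.Ls) {B : Set (Fin p → ℝ)} (hB : MeasurableSet B) {D : ℝ}
    (hD : ∀ β ∈ B, (∀ j, j ∉ S → β j = 0) →
      D ≤ ‖comb P.xw (β - P.βlarge)‖ ^ 2 / (32 * P.σ ^ 2)) :
    ENNReal.ofReal (P.q₀ ^ S.card * (1 - P.q₀) ^ (p - S.card)) *
      ∫⁻ β in B, P.ratio y β ∂slabOn S (P.η ^ 2 * P.σ ^ 2) ≤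
    ENNReal.ofReal (((p : ℝ)⁻¹) ^ S.card *
      Real.exp (-(S.card * Real.log p) + (2 + 4 * Cv) * P.Sstar.card * Real.log p - D)) := by
  have hσ := P.σ_pos
  have hη := P.η_pos
  have hq := P.q₀_pos
  have hq1 := P.q₀_lt_one
  have hp' : (0 : ℝ) < p := by exact_mod_cast hp
  have hN : (0 : ℝ) < P.N := by exact_mod_cast N_pos
  have hlog : 0 ≤ Real.log p := Real.log_natCast_nonneg p
  have hs' : (1 : ℝ) ≤ P.Sstar.card := by exact_mod_cast hs
  have hc : 0 < c₀ := by linarith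
  set L := Real.log p with hL
  set s := S.card with hs_def
  obtain ⟨c, hcβ⟩ := hX.logRatio_le hlam hc₀ hT hv hy hS
  set a := c₀ * lam * P.N / (32 * P.σ ^ 2) with ha
  have ha0 : 0 < a := by positivity
  set G := ((16 / (3 * lam) + 4 / 3) * s + 4 / 3 + 4 * Cv * P.Sstar.card) * L - D with hG
  have hint : ∫⁻ β in B, P.ratio y β ∂slabOn S (P.η ^ 2 * P.σ ^ 2) ≤
      ENNReal.ofReal (Real.exp G * (√(16 * κ / (c₀ * lam)) * Real.exp (-(r * L))) ^ s) := by
    calc _ ≤ ∫⁻ β in B, ENNReal.ofReal (Real.exp G) *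
          ENNReal.ofReal (Real.exp (-(a * ∑ j ∈ S, (β j - c j) ^ 2)))
          ∂slabOn S (P.η ^ 2 * P.σ ^ 2) := by
          refine lintegral_mono_ae ?_
          filter_upwards [ae_restrict_mem hB, ae_restrict_of_ae (ae_slabOn S _)] with β hβB hβ
          rw [ratio, ← ENNReal.ofReal_mul (Real.exp_pos _).le, ← Real.exp_add]
          refine ENNReal.ofReal_le_ofReal (Real.exp_le_exp.mpr ((hcβ β hβ).trans ?_))
          have := hD β hβB hβ
          rw [hG]
          linarith
      _ ≤ ∫⁻ β, ENNReal.ofReal (Real.exp G) *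
          ENNReal.ofReal (Real.exp (-(a * ∑ j ∈ S, (β j - c j) ^ 2)))
          ∂slabOn S (P.η ^ 2 * P.σ ^ 2) := setLIntegral_le_lintegral _ _
      _ ≤ ENNReal.ofReal (Real.exp G) *
          ENNReal.ofReal ((√(2 * a * (P.η ^ 2 * P.σ ^ 2)))⁻¹ ^ s) := by
          rw [lintegral_const_mul' _ _ ENNReal.ofReal_ne_top]
          gcongr
          exact lintegral_slabOn_exp_le S (by positivity) ha0 c
      _ ≤ _ := by
          rw [← ENNReal.ofReal_mul (Real.exp_pos _).le]
          refine ENNReal.ofReal_le_ofReal ?_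
          gcongr
          exact hPr.sqrt_inv_le hκ hc hlam hp
  have hw : P.q₀ ^ s * (1 - P.q₀) ^ (p - s) ≤ (κ * (p : ℝ)⁻¹) ^ s := by
    calc _ ≤ P.q₀ ^ s * 1 := by
          gcongr
          exact pow_le_one₀ (by linarith) (by linarith)
      _ ≤ _ := by rw [mul_one]; exact pow_le_pow_left₀ hq.le hPr.inclusion.2 s
  refine (mul_le_mul' (ENNReal.ofReal_le_ofReal hw) hint).trans ?_
  rw [← ENNReal.ofReal_mul (by positivity)]
  refine ENNReal.ofReal_le_ofReal ?_
  have hexp : Real.exp L = p := Real.exp_log hp'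
  calc (κ * (p : ℝ)⁻¹) ^ s * (Real.exp G * (√(16 * κ / (c₀ * lam)) * Real.exp (-(r * L))) ^ s)
      = ((p : ℝ)⁻¹) ^ s * ((κ * √(16 * κ / (c₀ * lam))) ^ s *
          (Real.exp (-(r * L)) ^ s * Real.exp G)) := by
        rw [mul_pow, mul_pow, mul_pow]; ring
    -- One power of `p` per covariate absorbs the constants; `p^{-s}` from the inclusion probability
    -- is kept for the sum over models.
    _ ≤ ((p : ℝ)⁻¹) ^ s * (Real.exp L ^ s * (Real.exp (-(r * L)) ^ s * Real.exp G)) := by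
        rw [hexp]; gcongr
    _ = ((p : ℝ)⁻¹) ^ s * Real.exp (s * L + (s * (-(r * L)) + G)) := by
        rw [← Real.exp_nat_mul, ← Real.exp_nat_mul, Real.exp_add, Real.exp_add]
    _ ≤ _ := by
        gcongr
        -- The exponent per covariate is then at most `1 - r + (r - 2) = -1`.
        have h1 : 16 / (3 * lam) + 4 / 3 ≤ r - 2 := by
          have h2 : 1 ≤ lam⁻¹ := (one_le_inv₀ hlam).mpr hlam1.le
          have h3 : 16 / (3 * lam) = 16 / 3 * lam⁻¹ := by field_simp
          rw [h3]; linarith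
        have h4 : (16 / (3 * lam) + 4 / 3) * (s * L) ≤ (r - 2) * (s * L) := by gcongr
        have h5 : L ≤ P.Sstar.card * L := le_mul_of_one_le_left hlog hs'
        rw [hG]
        nlinarith

theorem setLIntegral_priorβ (y : P.Data) {B : Set (Fin p → ℝ)} (hB : MeasurableSet B) :
    ∫⁻ β in B, P.ratio y β ∂P.priorβ = ∑ S : Finset (Fin p) with S.card ≤ P.Ls,
      ENNReal.ofReal (P.q₀ ^ S.card * (1 - P.q₀) ^ (p - S.card)) *
        ∫⁻ β in B, P.ratio y β ∂slabOn S (P.η ^ 2 * P.σ ^ 2) := by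
  rw [← lintegral_indicator hB, priorβ, lintegral_finsetSum_measure]
  refine Finset.sum_congr rfl fun S _ => ?_
  rw [lintegral_smul_measure, lintegral_indicator hB, smul_eq_mul]

/-- Either way a model gains `exp(-A s* log p)`: up to size `A s*` from the separation of the fits,
beyond it from the factor `exp(-|S| log p)`, with no separation needed. -/
theorem Design.numerator_le (hX : P.Design lam C₃ d₁ d₂) (hlam : 0 < lam)
    {c₀ C₁ C₂ Cv κ r : ℝ} (hc₀ : 1 / 2 < c₀) (hT : P.TrueModel c₀ C₁ C₂)
    (hPr : P.Prior κ r) (hκ : 0 < κ) (hlam1 : lam < 1) (hr : 1 + 8 * lam⁻¹ ≤ r)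
    (hv : ‖P.bias‖ ^ 2 ≤ Cv * P.σ ^ 2 * (P.Sstar.card * Real.log p)) (hs : 1 ≤ P.Sstar.card)
    (hp : 0 < p) (hpκ : κ * √(16 * κ / (c₀ * lam)) ≤ p) {y : P.Data} (hy : P.NoiseBound y)
    {B : Set (Fin p → ℝ)} (hB : MeasurableSet B) {A : ℝ}
    (hD : ∀ S : Finset (Fin p), S.card ≤ A * P.Sstar.card → ∀ β ∈ B, (∀ j, j ∉ S → β j = 0) →
      A * P.Sstar.card * Real.log p ≤ ‖comb P.xw (β - P.βlarge)‖ ^ 2 / (32 * P.σ ^ 2)) :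
    ∫⁻ β in B, P.ratio y β ∂P.priorβ ≤ ENNReal.ofReal
      (3 * Real.exp ((2 + 4 * Cv - A) * P.Sstar.card * Real.log p)) := by
  have hlog : 0 ≤ Real.log p := Real.log_natCast_nonneg p
  have hσ := P.σ_pos
  set E := Real.exp ((2 + 4 * Cv - A) * P.Sstar.card * Real.log p) with hE
  have hterm : ∀ S : Finset (Fin p), S.card ≤ P.Ls →
      ENNReal.ofReal (P.q₀ ^ S.card * (1 - P.q₀) ^ (p - S.card)) *
        ∫⁻ β in B, P.ratio y β ∂slabOn S (P.η ^ 2 * P.σ ^ 2) ≤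
      ENNReal.ofReal (((p : ℝ)⁻¹) ^ S.card * E) := by
    intro S hS
    by_cases hA : (S.card : ℝ) ≤ A * P.Sstar.card
    · refine (hX.weight_mul_setLIntegral_le hlam hc₀ hT hPr hκ hlam1 hr hv hs hp hpκ hy hS hB
        (hD S hA)).trans (ENNReal.ofReal_le_ofReal ?_)
      rw [hE]
      gcongr
      have : 0 ≤ S.card * Real.log p := by positivity
      linarith
    · refine (hX.weight_mul_setLIntegral_le hlam hc₀ hT hPr hκ hlam1 hr hv hs hp hpκ hy hS hB
        (D := 0) (fun β _ _ => by positivity)).trans (ENNReal.ofReal_le_ofReal ?_)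
      rw [hE]
      gcongr
      have := mul_le_mul_of_nonneg_right (not_le.mp hA).le hlog
      linarith
  rw [setLIntegral_priorβ y hB]
  calc _ ≤ ∑ S : Finset (Fin p) with S.card ≤ P.Ls, ENNReal.ofReal (((p : ℝ)⁻¹) ^ S.card * E) :=
        Finset.sum_le_sum fun S hS => hterm S (Finset.mem_filter.mp hS).2
    _ ≤ ∑ S : Finset (Fin p), ENNReal.ofReal (((p : ℝ)⁻¹) ^ S.card * E) :=
        Finset.sum_le_sum_of_subset (Finset.subset_univ _)
    _ = ENNReal.ofReal ((∑ S : Finset (Fin p), ((p : ℝ)⁻¹) ^ S.card) * E) := by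
        rw [Finset.sum_mul, ENNReal.ofReal_sum_of_nonneg (fun _ _ => by positivity)]
    _ ≤ _ := ENNReal.ofReal_le_ofReal
        (mul_le_mul_of_nonneg_right (sum_inv_pow_card_le hp) (Real.exp_pos _).le)

end Problem

namespace Problem

variable {K p : ℕ} {P : Problem K p}

/-! ### The denominator of the posterior -/

theorem exp_neg_two_mul_le_one_sub {q : ℝ} (hq0 : 0 ≤ q) (hq : q ≤ 1 / 2) :
    Real.exp (-(2 * q)) ≤ 1 - q := by
  rw [Real.exp_neg, inv_le_comm₀ (Real.exp_pos _) (by linarith)]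
  have h1 : 1 + 2 * q ≤ Real.exp (2 * q) := by linarith [Real.add_one_le_exp (2 * q)]
  refine le_trans ?_ h1
  rw [inv_le_iff_one_le_mul₀ (by linarith)]
  nlinarith

/-- `q₀ ≥ 1/(κp) ≥ p⁻²`, and `(1 - q₀)^p ≥ exp(-2κ)` as `q₀ ≤ κ/p ≤ 1/2`. -/
theorem Prior.le_weight {κ r : ℝ} (hPr : P.Prior κ r) (hκ : 0 < κ) (hp : 0 < p)
    (hpκ : 2 * κ ≤ p) :
    Real.exp (-(2 * P.Sstar.card * Real.log p) - 2 * κ) ≤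
      P.q₀ ^ P.Sstar.card * (1 - P.q₀) ^ (p - P.Sstar.card) := by
  have hp' : (0 : ℝ) < p := by exact_mod_cast hp
  have hq := P.q₀_pos
  have hq1 := P.q₀_lt_one
  have h1 : Real.exp (-(2 * P.Sstar.card * Real.log p)) ≤ P.q₀ ^ P.Sstar.card := by
    have e : Real.exp (-(2 * P.Sstar.card * Real.log p)) = (((p : ℝ)⁻¹) ^ 2) ^ P.Sstar.card := by
      rw [← pow_mul, ← exp_neg_nat_mul_log hp]
      push_cast; ring_nf
    rw [e]
    refine pow_le_pow_left₀ (by positivity) (le_trans ?_ hPr.inclusion.1) _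
    rw [sq]
    gcongr
    linarith
  have h2 : Real.exp (-(2 * κ)) ≤ (1 - P.q₀) ^ (p - P.Sstar.card) := by
    have hqκ : P.q₀ ≤ κ * (p : ℝ)⁻¹ := hPr.inclusion.2
    have hhalf : κ * (p : ℝ)⁻¹ ≤ 1 / 2 := by
      rw [← div_eq_mul_inv, div_le_iff₀ hp']; linarith
    calc Real.exp (-(2 * κ)) = Real.exp (-(2 * (κ * (p : ℝ)⁻¹))) ^ p := by
          rw [← Real.exp_nat_mul]; congr 1; field_simp
      _ ≤ Real.exp (-(2 * P.q₀)) ^ p := by gcongr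
      _ ≤ (1 - P.q₀) ^ p := by
          gcongr
          exact exp_neg_two_mul_le_one_sub hq.le (hqκ.trans hhalf)
      _ ≤ _ := pow_le_pow_of_le_one (by linarith) (by linarith) (Nat.sub_le _ _)
  rw [sub_eq_add_neg, Real.exp_add]
  exact mul_le_mul h1 h2 (Real.exp_pos _).le (by positivity)

/-- The slab is only polynomially wide, so placing a coefficient in a small interval costs a fixed
power of `p`. -/
theorem Prior.N_mul_sq_le {c₀ C₁ C₂ κ r : ℝ} (hPr : P.Prior κ r) (hκ : 0 < κ) (hr : 0 ≤ r)
    (hc₀ : 1 / 2 < c₀) (hT : P.TrueModel c₀ C₁ C₂) (hs : 1 ≤ P.Sstar.card)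
    (hN : (P.N : ℝ) ≤ (p : ℝ) ^ κ) (hp : 0 < p) :
    P.N * P.η ^ 2 ≤ 2 * κ * Real.exp ((κ + 2 * r) * Real.log p) := by
  have hp' : (0 : ℝ) < p := by exact_mod_cast hp
  have hlog : 0 ≤ Real.log p := Real.log_natCast_nonneg p
  have h1 : (P.N : ℝ) ≤ 2 * P.nS P.Sstar := by
    have h2 := le_nS_of_mem hT hs
    have h3 : (0 : ℝ) ≤ P.N := by positivity
    nlinarith
  have h4 : max (P.nS P.Sstar : ℝ) ((p : ℝ) ^ (2 * r)) ≤ Real.exp ((κ + 2 * r) * Real.log p) := by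
    refine max_le ?_ ?_
    · have h5 : (P.nS P.Sstar : ℝ) ≤ P.N := by exact_mod_cast nS_le_N _
      refine (h5.trans hN).trans ?_
      rw [Real.rpow_def_of_pos hp', mul_comm]
      gcongr
      linarith
    · rw [Real.rpow_def_of_pos hp', mul_comm]
      gcongr
      linarith
  calc P.N * P.η ^ 2 ≤ 2 * P.nS P.Sstar * P.η ^ 2 := by gcongr
    _ = 2 * (P.nS P.Sstar * P.η ^ 2) := by ring
    _ ≤ 2 * (κ * max (P.nS P.Sstar : ℝ) ((p : ℝ) ^ (2 * r))) :=
        mul_le_mul_of_nonneg_left hPr.slab.2 two_pos.le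
    _ ≤ 2 * (κ * Real.exp ((κ + 2 * r) * Real.log p)) := by gcongr
    _ = _ := by ring

/-- The slab gives enough mass to a small box around the large coefficients. -/
theorem Prior.le_slabOn_box {c₀ C₁ C₂ κ r Cb : ℝ} (hPr : P.Prior κ r) (hκ : 0 < κ)
    (hr : 0 ≤ r) (hc₀ : 1 / 2 < c₀) (hT : P.TrueModel c₀ C₁ C₂) (hs : 1 ≤ P.Sstar.card)
    (hN : (P.N : ℝ) ≤ (p : ℝ) ^ κ) (hp : 0 < p) (hpκ : 4 * κ ≤ p) (hlog1 : 1 ≤ Real.log p)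
    (hCb : 0 ≤ Cb) (hb : ∑ j, P.βlarge j ^ 2 ≤ Cb * P.σ ^ 2 * Real.log p) :
    ENNReal.ofReal (Real.exp (-((κ + 2 * r + 2 + (Cb + 1) * κ) * P.Sstar.card * Real.log p))) ≤
      slabOn P.Sstar (P.η ^ 2 * P.σ ^ 2) (Set.univ.pi fun j =>
        Set.Icc (P.βlarge j - P.σ / (√P.N * p)) (P.βlarge j + P.σ / (√P.N * p))) := by
  have hσ := P.σ_pos
  have hη := P.η_pos
  have hp' : (0 : ℝ) < p := by exact_mod_cast hp
  have hp1 : (1 : ℝ) ≤ p := by exact_mod_cast hp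
  have hN0 : (0 : ℝ) < P.N := by exact_mod_cast N_pos
  have hN1 : (1 : ℝ) ≤ P.N := by exact_mod_cast N_pos (P := P)
  have hs' : (1 : ℝ) ≤ P.Sstar.card := by exact_mod_cast hs
  set L := Real.log p with hL
  set s := P.Sstar.card with hs_def
  set ρ := P.σ / (√P.N * p) with hρ
  have hρσ : ρ ≤ P.σ := by
    refine div_le_self hσ.le ?_
    have : 1 ≤ √(P.N : ℝ) := Real.one_le_sqrt.mpr hN1
    nlinarith
  refine le_trans (ENNReal.ofReal_le_ofReal ?_)
    (Transfer.le_slabOn_box P.Sstar (by positivity) (by positivity) P.βlarge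
      fun j hj => P.βlarge_eq_zero hj)
  have h1 : Real.exp (-((κ + 2 * r + 2) * L)) ≤
      2 * ρ * (√(2 * Real.pi * (P.η ^ 2 * P.σ ^ 2)))⁻¹ := by
    have e1 : √(2 * Real.pi * (P.η ^ 2 * P.σ ^ 2)) * √P.N =
        P.σ * √(2 * Real.pi * (P.N * P.η ^ 2)) := by
      rw [← Real.sqrt_mul (by positivity)]
      nth_rewrite 2 [← Real.sqrt_sq hσ.le]
      rw [← Real.sqrt_mul (by positivity)]
      congr 1; ring
    have e2 : 2 * ρ * (√(2 * Real.pi * (P.η ^ 2 * P.σ ^ 2)))⁻¹ =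
        2 / (p * √(2 * Real.pi * (P.N * P.η ^ 2))) := by
      have h : √(2 * Real.pi * (P.η ^ 2 * P.σ ^ 2)) =
          P.σ * √(2 * Real.pi * (P.N * P.η ^ 2)) / √P.N := by
        rw [← e1]; field_simp
      rw [h, hρ]; field_simp
    have e3 : √(2 * Real.pi * (P.N * P.η ^ 2)) ≤ 2 * Real.exp ((κ + 2 * r + 1) * L) := by
      refine Real.sqrt_le_iff.mpr ⟨by positivity, ?_⟩
      have h2 := hPr.N_mul_sq_le hκ hr hc₀ hT hs hN hp
      have h3 : Real.exp ((κ + 2 * r + 1) * L) = Real.exp ((κ + 2 * r) * L) * p := by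
        rw [add_mul, one_mul, Real.exp_add, Real.exp_log hp']
      have h4 : 1 ≤ Real.exp ((κ + 2 * r) * L) := Real.one_le_exp (by positivity)
      have hpi : Real.pi < 4 := Real.pi_lt_four
      calc 2 * Real.pi * (P.N * P.η ^ 2)
          ≤ 2 * 4 * (2 * κ * Real.exp ((κ + 2 * r) * L)) := by gcongr
        _ = 4 * (4 * κ) * Real.exp ((κ + 2 * r) * L) := by ring
        _ ≤ 4 * p * Real.exp ((κ + 2 * r) * L) := by gcongr
        _ ≤ 4 * p ^ 2 * Real.exp ((κ + 2 * r) * L) ^ 2 := by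
            gcongr ?_ * ?_
            · nlinarith
            · nlinarith
        _ = _ := by rw [h3]; ring
    rw [e2]
    calc Real.exp (-((κ + 2 * r + 2) * L)) = 2 / (p * (2 * Real.exp ((κ + 2 * r + 1) * L))) := by
          have h5 : (κ + 2 * r + 2) * L = L + (κ + 2 * r + 1) * L := by ring
          rw [h5, Real.exp_neg, Real.exp_add, Real.exp_log hp']
          field_simp
      _ ≤ _ := by gcongr
  have h2 : -((Cb + 1) * κ * s * L) ≤
      -(∑ j, P.βlarge j ^ 2 + s * ρ ^ 2) / (P.η ^ 2 * P.σ ^ 2) := by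
    rw [neg_div, neg_le_neg_iff, div_le_iff₀ (by positivity)]
    -- The `n_{S*}` branch of the maximum keeps the slab from being too narrow for coefficients of
    -- squared size `O(σ² log p)`.
    have h3 : κ⁻¹ ≤ P.η ^ 2 := by
      have h4 := hPr.slab.1
      have h5 : (0 : ℝ) < P.nS P.Sstar := by exact_mod_cast nS_pos _
      have h6 : κ⁻¹ * P.nS P.Sstar ≤ P.nS P.Sstar * P.η ^ 2 :=
        (mul_le_mul_of_nonneg_left (le_max_left _ _) (by positivity)).trans h4
      rw [mul_comm] at h6
      exact le_of_mul_le_mul_left h6 h5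
    have h4 : 1 ≤ κ * P.η ^ 2 := by
      have := mul_le_mul_of_nonneg_left h3 hκ.le
      rwa [mul_inv_cancel₀ hκ.ne'] at this
    have h5 : ρ ^ 2 ≤ P.σ ^ 2 := by gcongr
    calc ∑ j, P.βlarge j ^ 2 + s * ρ ^ 2
        ≤ Cb * P.σ ^ 2 * L * s + s * P.σ ^ 2 * L := by
          refine add_le_add (hb.trans (le_mul_of_one_le_right (by positivity) hs')) ?_
          calc s * ρ ^ 2 ≤ s * P.σ ^ 2 := by gcongr
            _ ≤ _ := le_mul_of_one_le_right (by positivity) hlog1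
      _ = (Cb + 1) * s * L * P.σ ^ 2 * 1 := by ring
      _ ≤ (Cb + 1) * s * L * P.σ ^ 2 * (κ * P.η ^ 2) := by gcongr
      _ = _ := by ring
  calc Real.exp (-((κ + 2 * r + 2 + (Cb + 1) * κ) * s * L))
      = Real.exp (-((κ + 2 * r + 2) * L)) ^ s * Real.exp (-((Cb + 1) * κ * s * L)) := by
        rw [← Real.exp_nat_mul, ← Real.exp_add]; congr 1; ring
    _ ≤ _ := by gcongr

/-- Keep only the model `S*` and a box around `βlarge`. The exponent adds up the model weight (`2 +
2κ`), the ratio on the box (`3 + Cv`) and the slab mass of the box. -/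
theorem Design.denominator_ge (hX : P.Design lam C₃ d₁ d₂)
    {c₀ C₁ C₂ Cv Cb κ r : ℝ} (hc₀ : 1 / 2 < c₀) (hT : P.TrueModel c₀ C₁ C₂)
    (hPr : P.Prior κ r) (hκ : 0 < κ) (hr : 0 ≤ r)
    (hv : ‖P.bias‖ ^ 2 ≤ Cv * P.σ ^ 2 * (P.Sstar.card * Real.log p)) (hs : 1 ≤ P.Sstar.card)
    (hLs : P.Sstar.card ≤ P.Ls) (hN : (P.N : ℝ) ≤ (p : ℝ) ^ κ)
    (hp : 0 < p) (hpκ : 4 * κ ≤ p) (hlog1 : 1 ≤ Real.log p)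
    (hCb : 0 ≤ Cb) (hb : ∑ j, P.βlarge j ^ 2 ≤ Cb * P.σ ^ 2 * Real.log p)
    {y : P.Data} (hy : P.NoiseBound y) :
    ENNReal.ofReal (Real.exp (-((κ + 2 * r + 7 + (Cb + 3) * κ + Cv) *
      P.Sstar.card * Real.log p))) ≤ ∫⁻ β, P.ratio y β ∂P.priorβ := by
  have hσ := P.σ_pos
  have hp' : (0 : ℝ) < p := by exact_mod_cast hp
  have hN0 : (0 : ℝ) < P.N := by exact_mod_cast N_pos
  have hsN : 0 < √(P.N : ℝ) := Real.sqrt_pos.mpr hN0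
  have hs' : (1 : ℝ) ≤ P.Sstar.card := by exact_mod_cast hs
  set L := Real.log p with hL
  set s := P.Sstar.card with hs_def
  have hsL : 1 ≤ s * L := one_le_mul_of_one_le_of_one_le hs' hlog1
  set box : Set (Fin p → ℝ) := Set.univ.pi fun j =>
    Set.Icc (P.βlarge j - P.σ / (√P.N * p)) (P.βlarge j + P.σ / (√P.N * p)) with hbox
  have hboxm : MeasurableSet box := MeasurableSet.univ_pi fun j => measurableSet_Icc
  have hratio : ∀ β ∈ box, ENNReal.ofReal (Real.exp (-((3 + Cv) * s * L))) ≤ P.ratio y β := by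
    intro β hβ
    refine ENNReal.ofReal_le_ofReal (Real.exp_le_exp.mpr ?_)
    -- The half-width `σ / (√N p)` is chosen for this: the columns have norm at most `√N`, so the
    -- fit moves by at most `σ`.
    have hsum : ∑ j, |(β - P.βlarge) j| ≤ P.σ / √P.N := by
      calc ∑ j, |(β - P.βlarge) j| ≤ ∑ _j : Fin p, P.σ / (√P.N * p) := by
            refine Finset.sum_le_sum fun j _ => abs_le.mpr ?_
            have := hβ j (Set.mem_univ j)
            rw [Pi.sub_apply]
            exact ⟨by linarith [this.1], by linarith [this.2]⟩
        _ = _ := by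
            rw [Finset.sum_const, Finset.card_univ, Fintype.card_fin, nsmul_eq_mul]; field_simp
    have h1 := le_log_ratio P.xw (P.whiten (P.noise y)) P.bias hy.covariate
      (fun j => hX.norm_xw_le j) (by positivity) hsN.le _ hsum
    have h2 : P.σ / √P.N * (√P.N * (P.σ * √(2 * (2 * L)))) ≤ P.σ ^ 2 * (2 * L) := by
      have h3 : √(2 * (2 * L)) ≤ 2 * L := Real.sqrt_le_iff.mpr ⟨by positivity, by nlinarith⟩
      calc _ = P.σ ^ 2 * √(2 * (2 * L)) := by field_simp
        _ ≤ _ := by gcongr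
    have h4 : P.σ / √P.N * √P.N = P.σ := by field_simp
    rw [h4] at h1
    rw [le_div_iff₀ (by positivity), logRatio]
    refine le_trans ?_ h1
    have h5 : P.σ ^ 2 * L ≤ P.σ ^ 2 * (s * L) :=
      mul_le_mul_of_nonneg_left (le_mul_of_one_le_left (by linarith) hs') (by positivity)
    have h6 : P.σ ^ 2 * 1 ≤ P.σ ^ 2 * (s * L) := mul_le_mul_of_nonneg_left hsL (by positivity)
    have h7 : 0 ≤ Cv * P.σ ^ 2 * (s * L) := (sq_nonneg _).trans hv
    nlinarith
  have hmass := hPr.le_slabOn_box hκ hr hc₀ hT hs hN hp hpκ hlog1 hCb hb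
  have hweight := hPr.le_weight hκ hp (by linarith)
  have hterm : ENNReal.ofReal (P.q₀ ^ s * (1 - P.q₀) ^ (p - s)) *
      ∫⁻ β in Set.univ, P.ratio y β ∂slabOn P.Sstar (P.η ^ 2 * P.σ ^ 2) ≤
      ∫⁻ β, P.ratio y β ∂P.priorβ := by
    rw [← setLIntegral_univ (μ := P.priorβ), setLIntegral_priorβ y MeasurableSet.univ]
    exact Finset.single_le_sum (f := fun S : Finset (Fin p) =>
      ENNReal.ofReal (P.q₀ ^ S.card * (1 - P.q₀) ^ (p - S.card)) *
        ∫⁻ β in Set.univ, P.ratio y β ∂slabOn S (P.η ^ 2 * P.σ ^ 2)) (fun _ _ => zero_le)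
      (Finset.mem_filter.mpr ⟨Finset.mem_univ P.Sstar, hLs⟩)
  refine le_trans ?_ hterm
  calc _ ≤ ENNReal.ofReal (Real.exp (-(2 * s * L) - 2 * κ)) *
        (ENNReal.ofReal (Real.exp (-((3 + Cv) * s * L))) * ENNReal.ofReal
          (Real.exp (-((κ + 2 * r + 2 + (Cb + 1) * κ) * s * L)))) := by
        rw [← ENNReal.ofReal_mul (Real.exp_pos _).le, ← ENNReal.ofReal_mul (Real.exp_pos _).le,
          ← Real.exp_add, ← Real.exp_add]
        refine ENNReal.ofReal_le_ofReal (Real.exp_le_exp.mpr ?_)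
        have := mul_le_mul_of_nonneg_left hsL hκ.le
        nlinarith
    _ ≤ _ := by
        refine mul_le_mul' (ENNReal.ofReal_le_ofReal hweight) ?_
        rw [Measure.restrict_univ]
        calc _ ≤ ENNReal.ofReal (Real.exp (-((3 + Cv) * s * L))) *
              slabOn P.Sstar (P.η ^ 2 * P.σ ^ 2) box := mul_le_mul' le_rfl hmass
          _ = ∫⁻ β in box, ENNReal.ofReal (Real.exp (-((3 + Cv) * s * L)))
              ∂slabOn P.Sstar (P.η ^ 2 * P.σ ^ 2) := (setLIntegral_const _ _).symm
          _ ≤ ∫⁻ β in box, P.ratio y β ∂slabOn P.Sstar (P.η ^ 2 * P.σ ^ 2) :=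
              setLIntegral_mono' hboxm hratio
          _ ≤ _ := setLIntegral_le_lintegral _ _

end Problem

theorem sqrt_sum_sq_add_le {p : ℕ} (a b : Fin p → ℝ) :
    √(∑ j, (a j + b j) ^ 2) ≤ √(∑ j, a j ^ 2) + √(∑ j, b j ^ 2) := by
  have h := norm_add_le (WithLp.toLp 2 a : EuclideanSpace ℝ (Fin p)) (WithLp.toLp 2 b)
  simpa [EuclideanSpace.norm_eq] using h

namespace Problem

variable {K p : ℕ} {P : Problem K p}

/-! ### Contraction of the posterior -/

/-- `A` exceeds the sum of the exponents of numerator and denominator by one, so the quotient is at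
most `3 exp(-s* log p) ≤ 3/p`. -/
theorem Design.posterior_le (hX : P.Design lam C₃ d₁ d₂) (hlam : 0 < lam)
    {c₀ C₁ C₂ Cv Cb κ r A : ℝ} (hc₀ : 1 / 2 < c₀) (hT : P.TrueModel c₀ C₁ C₂)
    (hPr : P.Prior κ r) (hκ : 0 < κ) (hlam1 : lam < 1) (hr : 1 + 8 * lam⁻¹ ≤ r)
    (hv : ‖P.bias‖ ^ 2 ≤ Cv * P.σ ^ 2 * (P.Sstar.card * Real.log p)) (hs : 1 ≤ P.Sstar.card)
    (hA : A = 2 + 4 * Cv + (κ + 2 * r + 7 + (Cb + 3) * κ + Cv) + 1) (hCv : 0 ≤ Cv)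
    (hLs : (A + 1) * P.Sstar.card ≤ P.Ls) (hN : (P.N : ℝ) ≤ (p : ℝ) ^ κ)
    (hp : 0 < p) (hpκ : κ * √(16 * κ / (c₀ * lam)) ≤ p) (hpκ' : 4 * κ ≤ p)
    (hlog1 : 1 ≤ Real.log p) (hCb : 0 ≤ Cb)
    (hb : ∑ j, P.βlarge j ^ 2 ≤ Cb * P.σ ^ 2 * Real.log p) {y : P.Data} (hy : P.NoiseBound y)
    {B : Set (Fin p → ℝ)} (hB : MeasurableSet B)
    (hsep : ∀ β ∈ B, ∀ S : Finset (Fin p), S.card ≤ (A + 1) * P.Sstar.card →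
      (∀ j, j ∉ S → (β - P.βlarge) j = 0) → 32 * A / (c₀ * lam) *
        (P.σ ^ 2 * (P.Sstar.card * Real.log p)) ≤ P.N * ∑ j, (β - P.βlarge) j ^ 2) :
    P.posterior y {θ | θ.1 ∈ B} ≤ ENNReal.ofReal (3 * (p : ℝ)⁻¹) := by
  have hσ := P.σ_pos
  have hp' : (0 : ℝ) < p := by exact_mod_cast hp
  have hs' : (1 : ℝ) ≤ P.Sstar.card := by exact_mod_cast hs
  have hr0 : 0 ≤ r := by
    have : 0 < lam⁻¹ := inv_pos.mpr hlam
    linarith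
  have hA0 : 0 ≤ A := by rw [hA]; positivity
  have hSLs : P.Sstar.card ≤ P.Ls := by
    have : (P.Sstar.card : ℝ) ≤ P.Ls :=
      (le_mul_of_one_le_left (by positivity) (by linarith)).trans hLs
    exact_mod_cast this
  have hnum := hX.numerator_le (A := A) hlam hc₀ hT hPr hκ hlam1 hr hv hs hp hpκ hy hB
    (fun S hS β hβ hβS => by
      -- The difference `β - βlarge` lives on `S ∪ S*`; the extra `s*` in `(A + 1) s* ≤ Ls` lets the
      -- restricted eigenvalue apply there.
      have hcard : ((S ∪ P.Sstar).card : ℝ) ≤ (A + 1) * P.Sstar.card := by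
        have : ((S ∪ P.Sstar).card : ℝ) ≤ S.card + P.Sstar.card := by
          exact_mod_cast Finset.card_union_le _ _
        linarith
      have hsupp : ∀ j, j ∉ S ∪ P.Sstar → (β - P.βlarge) j = 0 := fun j hj => by
        rw [Finset.mem_union, not_or] at hj
        rw [Pi.sub_apply, hβS j hj.1, P.βlarge_eq_zero hj.2, sub_zero]
      have h1 := hsep β hβ _ hcard hsupp
      have h2 := hX.le_sq_norm_comb hlam hT (by exact_mod_cast hcard.trans hLs) hsupp
      rw [le_div_iff₀ (by positivity)]
      refine le_trans ?_ h2
      have hcl : 0 < c₀ * lam := by nlinarith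
      have h3 := mul_le_mul_of_nonneg_left h1 hcl.le
      calc A * P.Sstar.card * Real.log p * (32 * P.σ ^ 2)
          = c₀ * lam * (32 * A / (c₀ * lam) * (P.σ ^ 2 * (P.Sstar.card * Real.log p))) := by
            field_simp
        _ ≤ _ := h3
        _ = _ := by ring)
  have hden := hX.denominator_ge hc₀ hT hPr hκ hr0 hv hs hSLs hN hp hpκ' hlog1 hCb hb hy
  rw [P.posterior_eq_ratio y hB]
  refine (mul_le_mul' (ENNReal.inv_le_inv.mpr hden) hnum).trans ?_
  rw [← ENNReal.ofReal_inv_of_pos (Real.exp_pos _), ← ENNReal.ofReal_mul (by positivity)]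
  refine ENNReal.ofReal_le_ofReal ?_
  rw [← Real.exp_neg, mul_left_comm, ← Real.exp_add]
  refine mul_le_mul_of_nonneg_left ?_ (by norm_num)
  rw [← Real.exp_log hp', ← Real.exp_neg, Real.exp_log hp']
  refine Real.exp_le_exp.mpr ?_
  have : Real.log p ≤ P.Sstar.card * Real.log p := le_mul_of_one_le_left (by linarith) hs'
  rw [hA]
  linarith

end Problem

end Transfer

end

/-! ### The theorem: from contraction around the large coefficients to the two norms -/

theorem theorem2 (K : ℕ) (c₀ C₁ C₂ lam C₃ d₁ d₂ r κ : ℝ)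
    (hc₀ : 1 / 2 < c₀ ∧ c₀ < 1) (hC₁ : 0 < C₁) (hC₂ : 0 < C₂) (hlam : 0 < lam ∧ lam < 1)
    (hC₃ : 8 * lam⁻¹ ≤ C₃) (hd₁ : 0 < d₁ ∧ d₁ < 1) (hd₂ : 0 < d₂ ∧ d₂ < 1)
    (hr : 1 + 3 / 2 * C₁ * lam⁻¹ + C₂ + C₃ < r) (hκ : 0 < κ) :
    ∃ A c₂ c₃ c₄ M : ℝ, 0 < A ∧ 0 < c₂ ∧ 0 < c₃ ∧ 0 < c₄ ∧ 0 < M ∧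
      ∀ (p : ℕ) (P : Transfer.Problem K p),
        1 ≤ P.Sstar.card →
        A * P.Sstar.card ≤ P.Ls →
        (P.N : ℝ) ≤ (p : ℝ) ^ κ →
        (∀ S : Finset (Fin p), 1 ≤ S.card → S.card ≤ P.Ls → κ⁻¹ * Real.log p ≤ P.nS S) →
        P.TrueModel c₀ C₁ C₂ →
        P.Design lam C₃ d₁ d₂ →
        P.Prior κ r →
        P.LargeSignal C₁ C₂ lam C₃ d₁ d₂ r →
        P.NegligibleTail κ →
        ENNReal.ofReal (1 - c₃ * (p : ℝ) ^ (-c₄)) ≤ P.dataLaw P.θstar {y |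
          P.posterior y {θ | M * P.σ * P.Sstar.card * √(Real.log p / P.nS P.Sstar) ≤
              ∑ j, |θ.1 j - P.β j|} ≤ ENNReal.ofReal (c₂ * (p : ℝ)⁻¹) ∧
          P.posterior y {θ | M * P.σ * √(P.Sstar.card * Real.log p / P.nS P.Sstar) ≤
              √(∑ j, (θ.1 j - P.β j) ^ 2)} ≤ ENNReal.ofReal (c₂ * (p : ℝ)⁻¹)} := by
  obtain ⟨hlam, hlam1⟩ := hlam
  replace hc₀ := hc₀.1
  have hc0 : 0 < c₀ := by linarith
  have hli : 0 < lam⁻¹ := inv_pos.mpr hlam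
  have hr' : 1 + 8 * lam⁻¹ ≤ r := by
    have : 0 < 3 / 2 * C₁ * lam⁻¹ := by positivity
    linarith
  have hr0 : 0 ≤ r := by linarith
  set Cb := (2 * C₁ + C₂) / lam with hCb
  set Cv := 2 * C₂ + K * (κ / lam * (2 * C₁ + 2 * Cb)) with hCv
  set A := 2 + 4 * Cv + (κ + 2 * r + 7 + (Cb + 3) * κ + Cv) + 1 with hA
  -- `32 A / (c₀ lam)` is the required squared separation; `A + 1` pays for passing from `ℓ₁` to
  -- `ℓ₂` on `(A + 1) s*` coordinates.
  set R := √((A + 1) * (32 * A / (c₀ * lam))) with hR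
  -- Beyond `p₀` all size conditions on `p` hold; the `3` exceeds `e`, so `log p ≥ 1`.
  set p₀ := 3 + 4 * κ + κ * √(16 * κ / (c₀ * lam)) with hp₀
  have hCb0 : 0 ≤ Cb := by positivity
  have hCv0 : 0 ≤ Cv := by positivity
  have hA0 : 0 < A := by positivity
  have hR0 : 0 ≤ R := Real.sqrt_nonneg _
  have hR2 : R ^ 2 = (A + 1) * (32 * A / (c₀ * lam)) := Real.sq_sqrt (by positivity)
  have hp₀0 : 0 < p₀ := by positivity
  -- In `M = κ + R` the `κ` absorbs the true coefficients outside `S*` and `R` is left for the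
  -- distance to `βlarge`.
  refine ⟨A + 1, 3 + p₀, 5, 1, κ + R, by positivity, by positivity, by norm_num, one_pos,
    by positivity, ?_⟩
  intro p P hs hLs hN _ hT hX hPr _ hneg
  have hp : 0 < p := by
    obtain ⟨j, -⟩ := Finset.card_pos.mp hs
    exact j.pos
  have hp' : (0 : ℝ) < p := by exact_mod_cast hp
  rw [Real.rpow_neg_one]
  by_cases hlarge : p₀ ≤ p
  swap
  -- For `p < p₀` the claimed bound on the posterior exceeds 1, so there is nothing to prove.
  · have h1 : (1 : ENNReal) ≤ ENNReal.ofReal ((3 + p₀) * (p : ℝ)⁻¹) := by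
      rw [ENNReal.one_le_ofReal, ← div_eq_mul_inv, one_le_div hp']
      linarith
    have h2 : ENNReal.ofReal (1 - 5 * (p : ℝ)⁻¹) ≤ P.dataLaw P.θstar Set.univ := by
      rw [measure_univ, ENNReal.ofReal_le_one]
      have : 0 < (p : ℝ)⁻¹ := inv_pos.mpr hp'
      linarith
    exact h2.trans (measure_mono fun y _ => ⟨(P.posterior_le_one y _).trans h1,
      (P.posterior_le_one y _).trans h1⟩)
  refine (hX.dataLaw_noiseBound hp).trans (measure_mono fun y hy => ?_)
  have hsq : 0 ≤ κ * √(16 * κ / (c₀ * lam)) := by positivity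
  have hlog1 : 1 ≤ Real.log p := by
    rw [Real.le_log_iff_exp_le hp']
    linarith [Real.exp_one_lt_d9]
  have hs' : (1 : ℝ) ≤ P.Sstar.card := by exact_mod_cast hs
  have hn : (0 : ℝ) < P.nS P.Sstar := by exact_mod_cast Transfer.Problem.nS_pos _
  have hnN : (P.nS P.Sstar : ℝ) ≤ P.N := by exact_mod_cast Transfer.Problem.nS_le_N _
  have hσ := P.σ_pos
  have hv := hX.sq_norm_bias_le hlam hT hC₁.le hC₂.le hκ hPr.source_slab hs
  have hb := hX.sum_sq_βlarge_le hlam hT hC₂.le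
  have hle : ENNReal.ofReal (3 * (p : ℝ)⁻¹) ≤ ENNReal.ofReal ((3 + p₀) * (p : ℝ)⁻¹) :=
    ENNReal.ofReal_le_ofReal
      (mul_le_mul_of_nonneg_right (by linarith) (inv_nonneg.mpr hp'.le))
  -- A separation condition common to both norms: the factor `A + 1` is needed for `ℓ₁` and harmless
  -- for `ℓ₂`.
  have hpost : ∀ B : Set (Fin p → ℝ), MeasurableSet B →
      (∀ β ∈ B, ∀ S : Finset (Fin p), S.card ≤ (A + 1) * P.Sstar.card →
        (∀ j, j ∉ S → (β - P.βlarge) j = 0) →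
        R ^ 2 * (P.σ ^ 2 * (P.Sstar.card * Real.log p / P.nS P.Sstar)) ≤
          (A + 1) * ∑ j, (β - P.βlarge) j ^ 2) →
      P.posterior y {θ | θ.1 ∈ B} ≤ ENNReal.ofReal ((3 + p₀) * (p : ℝ)⁻¹) := by
    intro B hB hsep
    refine (hX.posterior_le hlam hc₀ hT hPr hκ hlam1 hr' hv hs hA hCv0 hLs hN hp
      (by linarith) (by linarith) hlog1 hCb0 hb hy hB ?_).trans hle
    intro β hβ S hS hβS
    have h1 := hsep β hβ S hS hβS
    rw [hR2, mul_assoc] at h1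
    have h2 := le_of_mul_le_mul_left h1 (by linarith)
    have h3 : 0 ≤ ∑ j, (β - P.βlarge) j ^ 2 := Finset.sum_nonneg fun _ _ => sq_nonneg _
    calc 32 * A / (c₀ * lam) * (P.σ ^ 2 * (P.Sstar.card * Real.log p))
        = P.nS P.Sstar * (32 * A / (c₀ * lam) *
          (P.σ ^ 2 * (P.Sstar.card * Real.log p / P.nS P.Sstar))) := by field_simp
      _ ≤ P.nS P.Sstar * ∑ j, (β - P.βlarge) j ^ 2 := mul_le_mul_of_nonneg_left h2 hn.le
      _ ≤ _ := mul_le_mul_of_nonneg_right hnN h3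
  have htail : ∀ j, P.βlarge j - P.β j = if j ∈ P.Sstarᶜ then -P.β j else 0 := by
    intro j
    by_cases hj : j ∈ P.Sstar <;> simp [Transfer.Problem.βlarge, hj]
  refine ⟨hpost {β | (κ + R) * P.σ * P.Sstar.card * √(Real.log p / P.nS P.Sstar) ≤
      ∑ j, |β j - P.β j|} (measurableSet_le measurable_const (by fun_prop)) ?_,
    hpost {β | (κ + R) * P.σ * √(P.Sstar.card * Real.log p / P.nS P.Sstar) ≤
      √(∑ j, (β j - P.β j) ^ 2)} (measurableSet_le measurable_const (by fun_prop)) ?_⟩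
  · intro β hβ S hS hβS
    have h1 : ∑ j, |β j - P.β j| ≤ ∑ j, |(β - P.βlarge) j| + ∑ j ∈ P.Sstarᶜ, |P.β j| := by
      have e : ∑ j ∈ P.Sstarᶜ, |P.β j| = ∑ j, |P.βlarge j - P.β j| := by
        simp_rw [htail, apply_ite abs, abs_neg, abs_zero]
        rw [Finset.sum_ite_mem, Finset.univ_inter]
      rw [e, ← Finset.sum_add_distrib]
      refine Finset.sum_le_sum fun j _ => ?_
      rw [Pi.sub_apply]
      exact abs_sub_le _ _ _
    have h2 : R * P.σ * P.Sstar.card * √(Real.log p / P.nS P.Sstar) ≤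
        ∑ j, |(β - P.βlarge) j| := by
      have h3 : (κ + R) * P.σ * P.Sstar.card * √(Real.log p / P.nS P.Sstar) ≤
        ∑ j, |β j - P.β j| := hβ
      have := hneg.l1
      linarith
    have h3 := pow_le_pow_left₀ (by positivity) h2 2
    rw [mul_pow, mul_pow, mul_pow,
      Real.sq_sqrt (show 0 ≤ Real.log p / P.nS P.Sstar by positivity)] at h3
    -- Cauchy–Schwarz on the sparse support; one factor `s*` then cancels against the squared `ℓ₁`
    -- rate.
    have h4 := Transfer.sq_sum_abs_le hβS
    have h5 : (S.card : ℝ) * ∑ j, (β - P.βlarge) j ^ 2 ≤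
        (A + 1) * P.Sstar.card * ∑ j, (β - P.βlarge) j ^ 2 :=
      mul_le_mul_of_nonneg_right hS (Finset.sum_nonneg fun _ _ => sq_nonneg _)
    refine le_of_mul_le_mul_left (a := (P.Sstar.card : ℝ)) ?_ (by linarith)
    calc _ = R ^ 2 * P.σ ^ 2 * (P.Sstar.card : ℝ) ^ 2 * (Real.log p / P.nS P.Sstar) := by ring
      _ ≤ (A + 1) * P.Sstar.card * ∑ j, (β - P.βlarge) j ^ 2 := h3.trans (h4.trans h5)
      _ = _ := by ring
  · intro β hβ S _ _
    have h1 := Transfer.sqrt_sum_sq_add_le (β - P.βlarge) (P.βlarge - P.β)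
    have e1 : ∀ j, (β - P.βlarge) j + (P.βlarge - P.β) j = β j - P.β j := fun j => by
      simp
    have e2 : ∑ j, (P.βlarge - P.β) j ^ 2 = ∑ j ∈ P.Sstarᶜ, P.β j ^ 2 := by
      simp_rw [Pi.sub_apply, htail, ite_pow, neg_sq, zero_pow two_ne_zero]
      rw [Finset.sum_ite_mem, Finset.univ_inter]
    simp_rw [e1] at h1
    rw [e2] at h1
    have h2 : R * P.σ * √(P.Sstar.card * Real.log p / P.nS P.Sstar) ≤
        √(∑ j, (β - P.βlarge) j ^ 2) := by
      have h3 : (κ + R) * P.σ * √(P.Sstar.card * Real.log p / P.nS P.Sstar) ≤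
        √(∑ j, (β j - P.β j) ^ 2) := hβ
      have := hneg.l2
      linarith
    have h5 : 0 ≤ ∑ j, (β - P.βlarge) j ^ 2 := Finset.sum_nonneg fun _ _ => sq_nonneg _
    have h3 := pow_le_pow_left₀ (by positivity) h2 2
    rw [mul_pow, mul_pow, Real.sq_sqrt h5,
      Real.sq_sqrt (show 0 ≤ P.Sstar.card * Real.log p / P.nS P.Sstar by positivity)] at h3
    calc _ = R ^ 2 * P.σ ^ 2 * (P.Sstar.card * Real.log p / P.nS P.Sstar) := by ring
      _ ≤ ∑ j, (β - P.βlarge) j ^ 2 := h3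
      _ ≤ _ := le_mul_of_one_le_left h5 (by linarith)
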